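/- **Theorem ($\lambda_{\mathrm{eff}}$ adequacy).** In the calculus $\lambda_{\mathrm{eff}}$ of effect handlers defined below, denotational equality implies contextual equivalence. For all $\Theta,\Gamma,A$ and values $P,Q$ with derivations of $\Theta;\Gamma\vdash P:A$ and $\Theta;\Gamma\vdash Q:A$, and likewise for all $\Theta,\Gamma,E,C$ and computations $P,Q$ with derivations of $\Theta;\Gamma\vdash_E P:C$ and $\Theta;\Gamma\vdash_E Q:C$: if $[\![P]\!]_\theta=[\![Q]\!]_\theta$ for every assignment $\theta$ of sets to type variables (the denotations being those of the given derivations), then $P\simeq Q$. *Types.* Effects $E=\{\mathsf{op}:A_{\mathsf{op}}\to B_{\mathsf{op}}\}_{\mathsf{op}\in O}$ ($O$ a finite set of operation names; $\emptyset$ is the pure effect); value types $A,B ::= \alpha \mid 1 \mid A\times B \mid \{\mathsf{inj}_\ell A_\ell\}_{\ell\in L}\ (L \text{ a finite set of labels}) \mid U_E C$; computation types $C,D ::= F A \mid A\to C \mid C\,\&\,D$; ground types $G ::= 1\mid G\times G\mid\{\mathsf{inj}_\ell G_\ell\}_{\ell\in L}$. A type is well-kinded over a finite set $\Theta$ of type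 variables if all its type variables lie in $\Theta$. An environment $\Gamma$ is a finite partial map from variables to value types. All judgements concern well-kinded environments, types and effects. *Terms.* Up to $\alpha$-equivalence: values $V ::= x\mid ()\mid (V,V)\mid \mathsf{inj}_\ell V\mid\{M\}$; computations $M,N ::= \mathsf{case}\,V\,\mathsf{of}\,(x_1,x_2)\to M \mid \mathsf{case}\,V\,\mathsf{of}\,\{\mathsf{inj}_\ell x_\ell\to M_\ell\}_{\ell\in L}\mid V!\mid\mathsf{return}\,V\mid\mathsf{let}\,x\leftarrow M\,\mathsf{in}\,N\mid\lambda x.M\mid M\,V\mid\langle M,N\rangle\mid\mathsf{prj}_i M\mid\mathsf{op}\,V\mid\mathsf{handle}\,M\,\mathsf{with}\,H$; handlers $H=\{\mathsf{return}\,x\mapsto N\}\uplus\{\mathsf{op}\,p\,k\mapsto N_{\mathsf{op}}\}_{\mathsf{op}\in O}$. *Typing.* The rules for variables, unit, pairs, variants, functions, computation pairs and their eliminations are the usual ones of call-by-push-value (premises and conclusion carry the same effect $E$, and a variant case split has exactly the labels of the variant type), together with: - $\Gamma\vdash\{M\}:U_EC$ if $\Gamma\vdash_E M:C$; $\Gamma\vdash_E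 V!:C$ if $\Gamma\vdash V:U_EC$; - $\Gamma\vdash_E\mathsf{return}\,V:FA$ if $\Gamma\vdash V:A$, for any $E$; $\Gamma\vdash_E \mathsf{let}\,x\leftarrow M\,\mathsf{in}\,N:C$ if $\Gamma\vdash_E M:FA$ and $\Gamma,x:A\vdash_E N:C$; - $\Gamma\vdash_E\mathsf{op}\,V:FB$ if $(\mathsf{op}:A\to B)\in E$ and $\Gamma\vdash V:A$; - $\Gamma\vdash_{E'}\mathsf{handle}\,M\,\mathsf{with}\,H:C$ if $\Gamma\vdash_EM:FA$ and $\Gamma\vdash H:A\,{}^{E}\!\Rightarrow^{E'}C$. The latter means that the operations of $H$ are exactly those of $E$, that $\Gamma,x:A\vdash_{E'}N:C$, and that $\Gamma,p:A_{\mathsf{op}},k:U_{E'}(B_{\mathsf{op}}\to C)\vdash_{E'}N_{\mathsf{op}}:C$ for each $(\mathsf{op}:A_{\mathsf{op}}\to B_{\mathsf{op}})\in E$. *Reduction.* $M\leadsto N$ is $\beta$-reduction inside an evaluation context, a stack of frames $\mathsf{let}\,x\leftarrow[\,]\,\mathsf{in}\,N$, $[\,]\,V$, $\mathsf{prj}_i[\,]$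 and $\mathsf{handle}\,[\,]\,\mathsf{with}\,H$. The $\beta$-rules are those of call-by-push-value (an elimination form meets the matching introduction form), $\mathsf{handle}\,(\mathsf{return}\,V)\,\mathsf{with}\,H\leadsto N[V/x]$, and the deep-handler rule $$\mathsf{handle}\,K[\mathsf{op}\,V]\,\mathsf{with}\,H\leadsto N_{\mathsf{op}}[V/p,\{\lambda y.\,\mathsf{handle}\,K[\mathsf{return}\,y]\,\mathsf{with}\,H\}/k],$$ where $H$ has a clause for $\mathsf{op}$, $K$ is a stack of frames of the first three kinds, and $y$ is fresh. $\leadsto^*$ is the reflexive-transitive closure. *Denotations.* Fix $\theta$. An effect $E$ denotes the free monad $T_E$ of the signature that has one symbol $\mathsf{op}_q$, of arity $[\![B]\!]$, for each $(\mathsf{op}:A\to B)\in E$ and $q\in[\![A]\!]$. Value types denote sets: $[\![\alpha]\!]=\theta(\alpha)$; $1$, products and variants denote the singleton, products and disjoint unions; $[\![U_EC]\!]$ is the carrier of the $T_E$-algebra $[\![C]\!]$. In a computation of effect $E$, $FA$ denotes the free $T_E$-algebra on $[\![A]\!]$, $A\to C$ the pointwise algebra on the functions $[\![A]\!]\to[\![C]\!]$,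 and $C\,\&\,D$ the product algebra. A derivation denotes a function from $[\![\Gamma]\!]=\prod_{x\in\mathrm{dom}\,\Gamma}[\![\Gamma(x)]\!]$ into $[\![A]\!]$, respectively the carrier of $[\![C]\!]$, defined by recursion in the standard way: thunking and forcing are identities, $\mathsf{return}$ is the unit, sequencing is the extension $c\circ T_E f: T_EX\to |[\![C]\!]|$ of $f:X\to|[\![C]\!]|$ along the algebra structure $c$ of $[\![C]\!]$, and $\mathsf{op}\,V$ denotes $\mathsf{op}_q\langle a\rangle_{a\in[\![B]\!]}$ with $q=[\![V]\!]$. A handler of type $A\,{}^{E}\!\Rightarrow^{E'}C$ denotes, at each environment, a pair of a $T_E$-algebra structure on the carrier of the $T_{E'}$-algebra $[\![C]\!]$, in which $\mathsf{op}_q\langle\xi_a\rangle_a$ is interpreted by the denotation of $N_{\mathsf{op}}$ at $p=q$, $k=(a\mapsto\xi_a)$, and the function from $[\![A]\!]$ to this carrier denoted by the return clause; $\mathsf{handle}\,M\,\mathsf{with}\,H$ denotes the extension of this function along this algebra structure, applied to $[\![M]\!]$. *Contextual equivalence.* Let $P,Q$ be well typed in $\Theta_0;\Gamma_0$, either both values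 of type $A_0$ or both computations of effect $E_0$ and type $C_0$. Their plugged contexts form the smallest family of tuples — $(\Theta,\Gamma,V_1,V_2,A)$ for values, $(\Theta,\Gamma,E,N_1,N_2,C)$ for computations, and $(\Theta,\Gamma,H_1,H_2,A,E,E',C)$ for handlers — that is closed under all typing rules (applied to both terms simultaneously) and contains $(\Theta,\Gamma,P,Q,A_0)$, respectively $(\Theta,\Gamma,E_0,P,Q,C_0)$, for all $\Theta\supseteq\Theta_0$ and well-kinded $\Gamma$ extending $\Gamma_0$. Then $P\simeq Q$ means: for every ground type $G$, every plugged context $(\emptyset,\emptyset,\emptyset,M_P,M_Q,FG)$ and every closed value $\vdash V:G$, one has $M_P\leadsto^*\mathsf{return}\,V$ if and only if $M_Q\leadsto^*\mathsf{return}\,V$. -/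

import Mathlib

/-!
The calculus of effect handlers on top of call-by-push-value: types, raw terms (de Bruijn
indices), operational semantics, kind and type system, set-theoretic denotational semantics,
and contextual equivalence.

Type variables, variant labels and operation names are natural numbers. A finite partial function
on labels or on operation names is a `Finset ℕ` with a function on its elements.
-/

universe u

namespace LamEff

/-! ### Types and effects -/

mutual
/-- Value types: `α`, `1`, `A₁ × A₂`, `{inj_ℓ A_ℓ | ℓ ∈ L}`, `U_E C`. -/
inductive VTy : Type
  | tvar (a : ℕ) : VTy
  | unit : VTy
  | prod (A B : VTy) : VTy
  | variant (L : Finset ℕ) (A : L → VTy) : VTy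
  | U (E : Eff) (C : CTy) : VTy
/-- Computation types: `F A`, `A → C`, `C₁ & C₂`. -/
inductive CTy : Type
  | F (A : VTy) : CTy
  | fn (A : VTy) (C : CTy) : CTy
  | prod (C D : CTy) : CTy
/-- Effect annotations: every operation name `o` of a finite set `O` has a parameter type `P o`
and a return type `R o`. -/
inductive Eff : Type
  | mk (O : Finset ℕ) (P R : O → VTy) : Eff
end

/-- The empty effect annotation. -/
def Eff.pure : Eff :=
  Eff.mk ∅ (fun o => absurd o.2 (Finset.notMem_empty o.1))
    (fun o => absurd o.2 (Finset.notMem_empty o.1))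

/-- Type environments are finite sets of type variables. -/
abbrev TyEnv := Finset ℕ

/-- Value environments; the type of the variable with de Bruijn index `n` stands in position `n`. -/
abbrev Env := List VTy

mutual
/-- `Θ ⊢ A : Val` -/
inductive KVal : TyEnv → VTy → Prop
  | tvar {Θ : TyEnv} {a : ℕ} (h : a ∈ Θ) : KVal Θ (.tvar a)
  | unit {Θ : TyEnv} : KVal Θ .unit
  | prod {Θ : TyEnv} {A B : VTy} (hA : KVal Θ A) (hB : KVal Θ B) : KVal Θ (.prod A B)
  | variant {Θ : TyEnv} {L : Finset ℕ} {A : L → VTy} (h : ∀ l : L, KVal Θ (A l)) :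
      KVal Θ (.variant L A)
  | U {Θ : TyEnv} {E : Eff} {C : CTy} (h : KComp Θ E C) : KVal Θ (.U E C)
/-- `Θ ⊢ C : Comp_E` -/
inductive KComp : TyEnv → Eff → CTy → Prop
  | F {Θ : TyEnv} {E : Eff} {A : VTy} (hE : KEff Θ E) (hA : KVal Θ A) : KComp Θ E (.F A)
  | fn {Θ : TyEnv} {E : Eff} {A : VTy} {C : CTy} (hA : KVal Θ A) (hC : KComp Θ E C) :
      KComp Θ E (.fn A C)
  | prod {Θ : TyEnv} {E : Eff} {C D : CTy} (hC : KComp Θ E C) (hD : KComp Θ E D) :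
      KComp Θ E (.prod C D)
/-- `Θ ⊢ E : Eff` -/
inductive KEff : TyEnv → Eff → Prop
  | mk {Θ : TyEnv} {O : Finset ℕ} {P R : O → VTy} (hP : ∀ o : O, KVal Θ (P o))
      (hR : ∀ o : O, KVal Θ (R o)) : KEff Θ (.mk O P R)
end

/-- `Θ ⊢ Γ : Ctxt` -/
def KCtx (Θ : TyEnv) (Γ : Env) : Prop := ∀ A ∈ Γ, KVal Θ A

/-- `Θ ⊢ (A ^E⇒^E' C) : Hndlr` -/
def KHdl (Θ : TyEnv) (A : VTy) (E E' : Eff) (C : CTy) : Prop :=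
  KVal Θ A ∧ KEff Θ E ∧ KEff Θ E' ∧ KComp Θ E' C

/-- Ground types: `1`, `G₁ × G₂`, `{inj_ℓ G_ℓ | ℓ ∈ L}`. -/
inductive Ground : VTy → Prop
  | unit : Ground .unit
  | prod {A B : VTy} (hA : Ground A) (hB : Ground B) : Ground (.prod A B)
  | variant {L : Finset ℕ} {A : L → VTy} (h : ∀ l : L, Ground (A l)) : Ground (.variant L A)

/-! ### Raw terms -/

mutual
/-- Value terms: `x`, `()`, `(V, W)`, `inj_ℓ V`, `{M}`. -/
inductive Val : Type
  | var (x : ℕ) : Val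
  | unit : Val
  | pair (V W : Val) : Val
  | inj (l : ℕ) (V : Val) : Val
  | thunk (M : Comp) : Val
/-- Computation terms. In `split V M`, that is `case V of (x₁, x₂) → M`, index `1` of `M` is `x₁`
and index `0` is `x₂`. -/
inductive Comp : Type
  | split (V : Val) (M : Comp) : Comp
  | case (V : Val) (L : Finset ℕ) (M : L → Comp) : Comp
  | force (V : Val) : Comp
  | ret (V : Val) : Comp
  | seq (M N : Comp) : Comp
  | lam (M : Comp) : Comp
  | app (M : Comp) (V : Val) : Comp
  | pair (M N : Comp) : Comp
  | prj1 (M : Comp) : Comp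
  | prj2 (M : Comp) : Comp
  | op (o : ℕ) (V : Val) : Comp
  | handle (M : Comp) (H : Hdl) : Comp
/-- Handlers: a return clause `N`, binding one variable, and for each operation name `o` of a
finite set `O` a clause `cl o`, binding the parameter (index `1`) and the continuation
(index `0`). -/
inductive Hdl : Type
  | mk (N : Comp) (O : Finset ℕ) (cl : O → Comp) : Hdl
end

/-- A renaming carried under one binder. -/
def upr (ρ : ℕ → ℕ) : ℕ → ℕ
  | 0 => 0
  | n + 1 => ρ n + 1

mutual
def Val.rename : Val → (ℕ → ℕ) → Val
  | .var x, ρ => .var (ρ x)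
  | .unit, _ => .unit
  | .pair V W, ρ => .pair (V.rename ρ) (W.rename ρ)
  | .inj l V, ρ => .inj l (V.rename ρ)
  | .thunk M, ρ => .thunk (M.rename ρ)
def Comp.rename : Comp → (ℕ → ℕ) → Comp
  | .split V M, ρ => .split (V.rename ρ) (M.rename (upr (upr ρ)))
  | .case V L M, ρ => .case (V.rename ρ) L (fun l => (M l).rename (upr ρ))
  | .force V, ρ => .force (V.rename ρ)
  | .ret V, ρ => .ret (V.rename ρ)
  | .seq M N, ρ => .seq (M.rename ρ) (N.rename (upr ρ))
  | .lam M, ρ => .lam (M.rename (upr ρ))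
  | .app M V, ρ => .app (M.rename ρ) (V.rename ρ)
  | .pair M N, ρ => .pair (M.rename ρ) (N.rename ρ)
  | .prj1 M, ρ => .prj1 (M.rename ρ)
  | .prj2 M, ρ => .prj2 (M.rename ρ)
  | .op o V, ρ => .op o (V.rename ρ)
  | .handle M H, ρ => .handle (M.rename ρ) (H.rename ρ)
def Hdl.rename : Hdl → (ℕ → ℕ) → Hdl
  | .mk N O cl, ρ => .mk (N.rename (upr ρ)) O (fun o => (cl o).rename (upr (upr ρ)))
end

/-- A substitution carried under one binder. -/
def ups (σ : ℕ → Val) : ℕ → Val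
  | 0 => .var 0
  | n + 1 => (σ n).rename Nat.succ

mutual
def Val.subst : Val → (ℕ → Val) → Val
  | .var x, σ => σ x
  | .unit, _ => .unit
  | .pair V W, σ => .pair (V.subst σ) (W.subst σ)
  | .inj l V, σ => .inj l (V.subst σ)
  | .thunk M, σ => .thunk (M.subst σ)
def Comp.subst : Comp → (ℕ → Val) → Comp
  | .split V M, σ => .split (V.subst σ) (M.subst (ups (ups σ)))
  | .case V L M, σ => .case (V.subst σ) L (fun l => (M l).subst (ups σ))
  | .force V, σ => .force (V.subst σ)
  | .ret V, σ => .ret (V.subst σ)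
  | .seq M N, σ => .seq (M.subst σ) (N.subst (ups σ))
  | .lam M, σ => .lam (M.subst (ups σ))
  | .app M V, σ => .app (M.subst σ) (V.subst σ)
  | .pair M N, σ => .pair (M.subst σ) (N.subst σ)
  | .prj1 M, σ => .prj1 (M.subst σ)
  | .prj2 M, σ => .prj2 (M.subst σ)
  | .op o V, σ => .op o (V.subst σ)
  | .handle M H, σ => .handle (M.subst σ) (H.subst σ)
def Hdl.subst : Hdl → (ℕ → Val) → Hdl
  | .mk N O cl, σ => .mk (N.subst (ups σ)) O (fun o => (cl o).subst (ups (ups σ)))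
end

/-- The substitution of `V` for index `0`. -/
def sub1 (V : Val) : ℕ → Val
  | 0 => V
  | n + 1 => .var n

/-- The substitution of `V` for index `1` and `W` for index `0`. -/
def sub2 (V W : Val) : ℕ → Val
  | 0 => W
  | 1 => V
  | n + 2 => .var n

/-! ### Operational semantics -/

/-- Basic frames: `let x ← [] in N`, `[] V`, `prj_i []`. -/
inductive BFrame : Type
  | seq (N : Comp) : BFrame
  | app (V : Val) : BFrame
  | prj1 : BFrame
  | prj2 : BFrame

def BFrame.plug : BFrame → Comp → Comp
  | .seq N, M => .seq M N
  | .app V, M => .app M V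
  | .prj1, M => .prj1 M
  | .prj2, M => .prj2 M

def BFrame.rename : BFrame → (ℕ → ℕ) → BFrame
  | .seq N, ρ => .seq (N.rename (upr ρ))
  | .app V, ρ => .app (V.rename ρ)
  | .prj1, _ => .prj1
  | .prj2, _ => .prj2

/-- Computation frames: basic frames and `handle [] with H`. -/
inductive Frame : Type
  | basic (B : BFrame) : Frame
  | handle (H : Hdl) : Frame

def Frame.plug : Frame → Comp → Comp
  | .basic B, M => B.plug M
  | .handle H, M => .handle M H

/-- Hoisting contexts: stacks of basic frames, outermost first. -/
abbrev HCtx := List BFrame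

def HCtx.plug : HCtx → Comp → Comp
  | [], M => M
  | B :: K, M => B.plug (HCtx.plug K M)

def HCtx.rename (K : HCtx) (ρ : ℕ → ℕ) : HCtx := List.map (fun B => B.rename ρ) K

/-- Evaluation contexts: stacks of computation frames, outermost first. -/
abbrev ECtx := List Frame

def ECtx.plug : ECtx → Comp → Comp
  | [], M => M
  | F :: K, M => F.plug (ECtx.plug K M)

/-- The `β`-reduction rules. -/
inductive Beta : Comp → Comp → Prop
  | split (V W : Val) (M : Comp) : Beta (.split (.pair V W) M) (M.subst (sub2 V W))
  | case (l : ℕ) (V : Val) (L : Finset ℕ) (M : L → Comp) (hl : l ∈ L) :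
      Beta (.case (.inj l V) L M) ((M ⟨l, hl⟩).subst (sub1 V))
  | seq (V : Val) (N : Comp) : Beta (.seq (.ret V) N) (N.subst (sub1 V))
  | force (M : Comp) : Beta (.force (.thunk M)) M
  | app (M : Comp) (V : Val) : Beta (.app (.lam M) V) (M.subst (sub1 V))
  | prj1 (M N : Comp) : Beta (.prj1 (.pair M N)) M
  | prj2 (M N : Comp) : Beta (.prj2 (.pair M N)) N
  | handleRet (V : Val) (N : Comp) (O : Finset ℕ) (cl : O → Comp) :
      Beta (.handle (.ret V) (.mk N O cl)) (N.subst (sub1 V))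
  | handleOp (K : HCtx) (o : ℕ) (V : Val) (N : Comp) (O : Finset ℕ) (cl : O → Comp)
      (ho : o ∈ O) :
      Beta (.handle (K.plug (.op o V)) (.mk N O cl))
        ((cl ⟨o, ho⟩).subst (sub2 V (.thunk (.lam
          (.handle ((K.rename Nat.succ).plug (.ret (.var 0)))
            ((Hdl.mk N O cl).rename Nat.succ))))))

/-- One-step reduction: `β`-reduction in an evaluation context. -/
inductive Step : Comp → Comp → Prop
  | mk (K : ECtx) {M N : Comp} (h : Beta M N) : Step (K.plug M) (K.plug N)

/-- `M ⟶* N` -/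
def Steps : Comp → Comp → Prop := Relation.ReflTransGen Step

/-! ### Type system -/

/-- Side condition of every value judgement. -/
def JVal (Θ : TyEnv) (Γ : Env) (A : VTy) : Prop := KCtx Θ Γ ∧ KVal Θ A

/-- Side condition of every computation judgement. -/
def JComp (Θ : TyEnv) (Γ : Env) (E : Eff) (C : CTy) : Prop :=
  KCtx Θ Γ ∧ KEff Θ E ∧ KComp Θ E C

/-- Side condition of every handler judgement. -/
def JHdl (Θ : TyEnv) (Γ : Env) (A : VTy) (E E' : Eff) (C : CTy) : Prop :=
  KCtx Θ Γ ∧ KHdl Θ A E E' C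

/-- `Lookup Γ x A`: the variable `x` has type `A` in `Γ`. -/
inductive Lookup : Env → ℕ → VTy → Type
  | zero {Γ : Env} {A : VTy} : Lookup (A :: Γ) 0 A
  | succ {Γ : Env} {A B : VTy} {x : ℕ} (h : Lookup Γ x A) : Lookup (B :: Γ) (x + 1) A

mutual
/-- Derivations of `Θ; Γ ⊢ V : A`. -/
inductive DVal : TyEnv → Env → Val → VTy → Type
  | var {Θ : TyEnv} {Γ : Env} {x : ℕ} {A : VTy} (j : JVal Θ Γ A) (h : Lookup Γ x A) :
      DVal Θ Γ (.var x) A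
  | unit {Θ : TyEnv} {Γ : Env} (j : JVal Θ Γ .unit) : DVal Θ Γ .unit .unit
  | pair {Θ : TyEnv} {Γ : Env} {V W : Val} {A B : VTy} (j : JVal Θ Γ (.prod A B))
      (dV : DVal Θ Γ V A) (dW : DVal Θ Γ W B) : DVal Θ Γ (.pair V W) (.prod A B)
  | inj {Θ : TyEnv} {Γ : Env} {l : ℕ} {V : Val} {L : Finset ℕ} {A : L → VTy}
      (j : JVal Θ Γ (.variant L A)) (hl : l ∈ L) (dV : DVal Θ Γ V (A ⟨l, hl⟩)) :
      DVal Θ Γ (.inj l V) (.variant L A)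
  | thunk {Θ : TyEnv} {Γ : Env} {E : Eff} {M : Comp} {C : CTy} (j : JVal Θ Γ (.U E C))
      (dM : DComp Θ Γ E M C) : DVal Θ Γ (.thunk M) (.U E C)
/-- Derivations of `Θ; Γ ⊢_E M : C`. -/
inductive DComp : TyEnv → Env → Eff → Comp → CTy → Type
  | split {Θ : TyEnv} {Γ : Env} {E : Eff} {V : Val} {M : Comp} {A B : VTy} {C : CTy}
      (j : JComp Θ Γ E C) (dV : DVal Θ Γ V (.prod A B)) (dM : DComp Θ (B :: A :: Γ) E M C) :
      DComp Θ Γ E (.split V M) C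
  | case {Θ : TyEnv} {Γ : Env} {E : Eff} {V : Val} {L : Finset ℕ} {M : L → Comp} {A : L → VTy}
      {C : CTy} (j : JComp Θ Γ E C) (dV : DVal Θ Γ V (.variant L A))
      (dM : ∀ l : L, DComp Θ (A l :: Γ) E (M l) C) : DComp Θ Γ E (.case V L M) C
  | force {Θ : TyEnv} {Γ : Env} {E : Eff} {V : Val} {C : CTy} (j : JComp Θ Γ E C)
      (dV : DVal Θ Γ V (.U E C)) : DComp Θ Γ E (.force V) C
  | ret {Θ : TyEnv} {Γ : Env} {E : Eff} {V : Val} {A : VTy} (j : JComp Θ Γ E (.F A))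
      (dV : DVal Θ Γ V A) : DComp Θ Γ E (.ret V) (.F A)
  | seq {Θ : TyEnv} {Γ : Env} {E : Eff} {M N : Comp} {A : VTy} {C : CTy} (j : JComp Θ Γ E C)
      (dM : DComp Θ Γ E M (.F A)) (dN : DComp Θ (A :: Γ) E N C) : DComp Θ Γ E (.seq M N) C
  | lam {Θ : TyEnv} {Γ : Env} {E : Eff} {M : Comp} {A : VTy} {C : CTy}
      (j : JComp Θ Γ E (.fn A C)) (dM : DComp Θ (A :: Γ) E M C) : DComp Θ Γ E (.lam M) (.fn A C)
  | app {Θ : TyEnv} {Γ : Env} {E : Eff} {M : Comp} {V : Val} {A : VTy} {C : CTy}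
      (j : JComp Θ Γ E C) (dM : DComp Θ Γ E M (.fn A C)) (dV : DVal Θ Γ V A) :
      DComp Θ Γ E (.app M V) C
  | pair {Θ : TyEnv} {Γ : Env} {E : Eff} {M N : Comp} {C D : CTy} (j : JComp Θ Γ E (.prod C D))
      (dM : DComp Θ Γ E M C) (dN : DComp Θ Γ E N D) : DComp Θ Γ E (.pair M N) (.prod C D)
  | prj1 {Θ : TyEnv} {Γ : Env} {E : Eff} {M : Comp} {C D : CTy} (j : JComp Θ Γ E C)
      (dM : DComp Θ Γ E M (.prod C D)) : DComp Θ Γ E (.prj1 M) C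
  | prj2 {Θ : TyEnv} {Γ : Env} {E : Eff} {M : Comp} {C D : CTy} (j : JComp Θ Γ E D)
      (dM : DComp Θ Γ E M (.prod C D)) : DComp Θ Γ E (.prj2 M) D
  | op {Θ : TyEnv} {Γ : Env} {O : Finset ℕ} {P R : O → VTy} {o : ℕ} {V : Val} (ho : o ∈ O)
      (j : JComp Θ Γ (.mk O P R) (.F (R ⟨o, ho⟩))) (dV : DVal Θ Γ V (P ⟨o, ho⟩)) :
      DComp Θ Γ (.mk O P R) (.op o V) (.F (R ⟨o, ho⟩))
  | handle {Θ : TyEnv} {Γ : Env} {E E' : Eff} {M : Comp} {H : Hdl} {A : VTy} {C : CTy}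
      (j : JComp Θ Γ E' C) (dM : DComp Θ Γ E M (.F A)) (dH : DHdl Θ Γ H A E E' C) :
      DComp Θ Γ E' (.handle M H) C
/-- Derivations of `Θ; Γ ⊢ H : A ^E⇒^E' C`. -/
inductive DHdl : TyEnv → Env → Hdl → VTy → Eff → Eff → CTy → Type
  | mk {Θ : TyEnv} {Γ : Env} {N : Comp} {O : Finset ℕ} {cl : O → Comp} {P R : O → VTy}
      {A : VTy} {E' : Eff} {C : CTy} (j : JHdl Θ Γ A (.mk O P R) E' C)
      (dN : DComp Θ (A :: Γ) E' N C)
      (dcl : ∀ o : O, DComp Θ (.U E' (.fn (R o) C) :: P o :: Γ) E' (cl o) C) :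
      DHdl Θ Γ (.mk N O cl) A (.mk O P R) E' C
end

/-! ### Signatures, free monads and algebras -/

/-- A signature: a set of operation symbols with (possibly infinite) arities. -/
structure Sig : Type (u + 1) where
  Sym : Type u
  ar : Sym → Type u

/-- The set `T_S X` of `S`-terms over `X`. -/
inductive Free (S : Sig.{u}) (X : Type u) : Type u
  | ret (x : X) : Free S X
  | op (f : S.Sym) (t : S.ar f → Free S X) : Free S X

/-- Simultaneous substitution, the monadic bind of `T_S`. -/
def Free.bind {S : Sig.{u}} {X Y : Type u} : Free S X → (X → Free S Y) → Free S Y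
  | .ret x, f => f x
  | .op g t, f => .op g (fun a => (t a).bind f)

/-- The functorial action of `T_S`. -/
def Free.fmap {S : Sig.{u}} {X Y : Type u} (f : X → Y) (t : Free S X) : Free S Y :=
  t.bind (fun x => .ret (f x))

/-- `T_S`-algebra structures on the set `X`. -/
structure AlgStr (S : Sig.{u}) (X : Type u) : Type u where
  str : Free S X → X
  str_ret : ∀ x : X, str (.ret x) = x
  str_fmap : ∀ t : Free S (Free S X), str (t.fmap str) = str (t.bind id)

/-- `T_S`-algebras. -/
structure Alg (S : Sig.{u}) : Type (u + 1) where
  carrier : Type u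
  alg : AlgStr S carrier

theorem Free.bind_assoc {S : Sig.{u}} {X Y Z : Type u} (t : Free S X) (f : X → Free S Y)
    (g : Y → Free S Z) : (t.bind f).bind g = t.bind (fun x => (f x).bind g) := by
  induction t with
  | ret x => rfl
  | op h t ih => simp only [Free.bind, ih]

theorem Free.fmap_bind {S : Sig.{u}} {X Y Z : Type u} (t : Free S X) (f : X → Y)
    (g : Y → Free S Z) : (t.fmap f).bind g = t.bind (fun x => g (f x)) :=
  Free.bind_assoc t _ g

theorem Free.bind_fmap {S : Sig.{u}} {X Y Z : Type u} (t : Free S X) (f : X → Free S Y)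
    (g : Y → Z) : (t.bind f).fmap g = t.bind (fun x => (f x).fmap g) :=
  Free.bind_assoc t f _

theorem Free.fmap_fmap {S : Sig.{u}} {X Y Z : Type u} (t : Free S X) (f : X → Y) (g : Y → Z) :
    (t.fmap f).fmap g = t.fmap (fun x => g (f x)) :=
  Free.fmap_bind t f _

/-- The Kleisli extension of `f : X → Y` to a map `T_S X → Y` into an algebra. -/
def AlgStr.ext {S : Sig.{u}} {X Y : Type u} (c : AlgStr S Y) (f : X → Y) (t : Free S X) : Y :=
  c.str (t.fmap f)

/-- The free algebra over `X`. -/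
def Alg.free (S : Sig.{u}) (X : Type u) : Alg S where
  carrier := Free S X
  alg :=
    { str := fun t => t.bind id
      str_ret := fun _ => rfl
      str_fmap := fun t => by rw [Free.fmap_bind, Free.bind_assoc]; rfl }

/-- The algebra of functions from a set into an algebra. -/
def Alg.fn {S : Sig.{u}} (X : Type u) (C : Alg S) : Alg S where
  carrier := X → C.carrier
  alg :=
    { str := fun t x => C.alg.str (t.fmap (fun f : X → C.carrier => f x))
      str_ret := fun f => funext fun x => C.alg.str_ret (f x)
      str_fmap := fun t => funext fun x => by
        have h := C.alg.str_fmap (t.fmap (fun s => s.fmap (fun f : X → C.carrier => f x)))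
        rw [Free.fmap_fmap, Free.fmap_bind] at h
        rw [Free.fmap_fmap, Free.bind_fmap]
        exact h }

/-- The product of two algebras. -/
def Alg.prod {S : Sig.{u}} (C D : Alg S) : Alg S where
  carrier := C.carrier × D.carrier
  alg :=
    { str := fun t => (C.alg.str (t.fmap Prod.fst), D.alg.str (t.fmap Prod.snd))
      str_ret := fun p => Prod.ext (C.alg.str_ret p.1) (D.alg.str_ret p.2)
      str_fmap := fun t => by
        have h1 := C.alg.str_fmap (t.fmap (fun s => s.fmap Prod.fst))
        have h2 := D.alg.str_fmap (t.fmap (fun s => s.fmap Prod.snd))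
        rw [Free.fmap_fmap, Free.fmap_bind] at h1 h2
        rw [Free.fmap_fmap, Free.fmap_fmap, Free.bind_fmap, Free.bind_fmap]
        exact Prod.ext h1 h2 }

/-- Evaluation of `S`-terms over `X` in an `S`-algebra with carrier `X`. -/
def Free.eval {S : Sig.{u}} {X : Type u} (a : ∀ f : S.Sym, (S.ar f → X) → X) : Free S X → X
  | .ret x => x
  | .op f t => a f (fun i => (t i).eval a)

/-- The `T_S`-algebra structure that corresponds to an `S`-algebra on the same carrier. -/
def AlgStr.ofOps {S : Sig.{u}} {X : Type u} (a : ∀ f : S.Sym, (S.ar f → X) → X) :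
    AlgStr S X where
  str := Free.eval a
  str_ret := fun _ => rfl
  str_fmap := fun t => by
    induction t with
    | ret t => rfl
    | op f t ih => exact congrArg (a f) (funext ih)

/-! ### Denotational semantics -/

/-- Assignments of sets to type variables. -/
abbrev TyAssign : Type (u + 1) := ℕ → Type u

mutual
/-- The set denoted by a value type. -/
def VTy.sem (θ : TyAssign.{u}) : VTy → Type u
  | .tvar a => θ a
  | .unit => PUnit
  | .prod A B => A.sem θ × B.sem θ
  | .variant L A => Σ l : L, (A l).sem θ
  | .U E C => (C.sem θ (E.sem θ)).carrier
/-- The algebra denoted by a computation type, for the signature of its effect annotation. -/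
def CTy.sem (θ : TyAssign.{u}) : CTy → (S : Sig.{u}) → Alg S
  | .F A, S => Alg.free S (A.sem θ)
  | .fn A C, S => Alg.fn (A.sem θ) (C.sem θ S)
  | .prod C D, S => Alg.prod (C.sem θ S) (D.sem θ S)
/-- The signature of an effect annotation: its symbols are the operation names tagged by an element
of the denotation of their parameter type, and the arity is the denotation of the return type.
The annotation denotes the free monad `Free` over this signature. -/
def Eff.sem (θ : TyAssign.{u}) : Eff → Sig.{u}
  | .mk O P R => { Sym := Σ o : O, (P o).sem θ, ar := fun f => (R f.1).sem θ }
end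

/-- The set denoted by a computation type of effect `E`. -/
abbrev CTy.car (θ : TyAssign.{u}) (E : Eff) (C : CTy) : Type u := (C.sem θ (E.sem θ)).carrier

/-- The set denoted by a value environment. -/
def Env.sem (θ : TyAssign.{u}) : Env → Type u
  | [] => PUnit
  | A :: Γ => A.sem θ × Env.sem θ Γ

/-- The set denoted by the handler type `A ^E⇒^E' C`: algebra structures for `E` on the carrier of
the denotation of `C`, paired with functions from the denotation of `A` into this carrier. -/
abbrev HdlSem (θ : TyAssign.{u}) (A : VTy) (E E' : Eff) (C : CTy) : Type u :=
  AlgStr (E.sem θ) (C.car θ E') × (A.sem θ → C.car θ E')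

/-- The projection denoted by a variable. -/
def Lookup.sem (θ : TyAssign.{u}) {Γ : Env} {x : ℕ} {A : VTy} :
    Lookup Γ x A → Env.sem θ Γ → A.sem θ
  | .zero, γ => γ.1
  | .succ h, γ => h.sem θ γ.2

mutual
/-- The denotation of a derivation for a value term. -/
def DVal.sem (θ : TyAssign.{u}) {Θ : TyEnv} {Γ : Env} {V : Val} {A : VTy} :
    DVal Θ Γ V A → Env.sem θ Γ → A.sem θ
  | .var _ h, γ => h.sem θ γ
  | .unit _, _ => PUnit.unit
  | .pair _ dV dW, γ => (dV.sem θ γ, dW.sem θ γ)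
  | .inj _ hl dV, γ => ⟨⟨_, hl⟩, dV.sem θ γ⟩
  | .thunk _ dM, γ => dM.sem θ γ
/-- The denotation of a derivation for a computation term. -/
def DComp.sem (θ : TyAssign.{u}) {Θ : TyEnv} {Γ : Env} {E : Eff} {M : Comp} {C : CTy} :
    DComp Θ Γ E M C → Env.sem θ Γ → C.car θ E
  | .split _ dV dM, γ => dM.sem θ ((dV.sem θ γ).2, (dV.sem θ γ).1, γ)
  | .case _ dV dM, γ => (dM (dV.sem θ γ).1).sem θ ((dV.sem θ γ).2, γ)
  | .force _ dV, γ => dV.sem θ γ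
  | .ret _ dV, γ => Free.ret (dV.sem θ γ)
  | @DComp.seq _ _ E _ _ _ C _ dM dN, γ =>
      (C.sem θ (E.sem θ)).alg.ext (fun a => dN.sem θ (a, γ)) (dM.sem θ γ)
  | .lam _ dM, γ => fun a => dM.sem θ (a, γ)
  | .app _ dM dV, γ => (dM.sem θ γ) (dV.sem θ γ)
  | .pair _ dM dN, γ => (dM.sem θ γ, dN.sem θ γ)
  | .prj1 _ dM, γ => (dM.sem θ γ).1
  | .prj2 _ dM, γ => (dM.sem θ γ).2
  | .op ho _ dV, γ => Free.op ⟨⟨_, ho⟩, dV.sem θ γ⟩ (fun a => Free.ret a)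
  | .handle _ dM dH, γ => (dH.sem θ γ).1.ext (dH.sem θ γ).2 (dM.sem θ γ)
/-- The denotation of a derivation for a handler. -/
def DHdl.sem (θ : TyAssign.{u}) {Θ : TyEnv} {Γ : Env} {H : Hdl} {A : VTy} {E E' : Eff} {C : CTy} :
    DHdl Θ Γ H A E E' C → Env.sem θ Γ → HdlSem θ A E E' C
  | .mk _ dN dcl, γ =>
      (AlgStr.ofOps (fun f k => (dcl f.1).sem θ (k, f.2, γ)), fun a => dN.sem θ (a, γ))
end

/-! ### Plugged contexts and contextual equivalence -/

/-- `Γ` extends `Γ₀`; the injective renaming `ρ` says which variable of `Γ` each variable of `Γ₀`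
becomes. -/
def Extends (Γ₀ Γ : Env) (ρ : ℕ → ℕ) : Prop :=
  Set.InjOn ρ {x | x < Γ₀.length} ∧
    ∀ (x : ℕ) (A : VTy), Γ₀[x]? = some A → Γ[ρ x]? = some A

/-- Pairs of phrases of the same type: the two terms to be plugged into a context. -/
inductive Hole : Type
  | val (Θ₀ : TyEnv) (Γ₀ : Env) (V₁ V₂ : Val) (A₀ : VTy) : Hole
  | comp (Θ₀ : TyEnv) (Γ₀ : Env) (E₀ : Eff) (M₁ M₂ : Comp) (C₀ : CTy) : Hole

mutual
/-- The tuples `⟨Θ, Γ, V₁, V₂, A⟩` of contexts plugged with the two phrases of a hole. -/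
inductive PVal : Hole → TyEnv → Env → Val → Val → VTy → Prop
  | hole {Θ₀ Θ : TyEnv} {Γ₀ Γ : Env} {V₁ V₂ : Val} {A : VTy} {ρ : ℕ → ℕ} (j : JVal Θ Γ A)
      (hΘ : Θ₀ ⊆ Θ) (hΓ : Extends Γ₀ Γ ρ) :
      PVal (.val Θ₀ Γ₀ V₁ V₂ A) Θ Γ (V₁.rename ρ) (V₂.rename ρ) A
  | var {h : Hole} {Θ : TyEnv} {Γ : Env} {x : ℕ} {A : VTy} (j : JVal Θ Γ A)
      (hx : Γ[x]? = some A) : PVal h Θ Γ (.var x) (.var x) A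
  | unit {h : Hole} {Θ : TyEnv} {Γ : Env} (j : JVal Θ Γ .unit) : PVal h Θ Γ .unit .unit .unit
  | pair {h : Hole} {Θ : TyEnv} {Γ : Env} {V₁ V₂ W₁ W₂ : Val} {A B : VTy}
      (j : JVal Θ Γ (.prod A B)) (pV : PVal h Θ Γ V₁ V₂ A) (pW : PVal h Θ Γ W₁ W₂ B) :
      PVal h Θ Γ (.pair V₁ W₁) (.pair V₂ W₂) (.prod A B)
  | inj {h : Hole} {Θ : TyEnv} {Γ : Env} {l : ℕ} {V₁ V₂ : Val} {L : Finset ℕ} {A : L → VTy}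
      (j : JVal Θ Γ (.variant L A)) (hl : l ∈ L) (pV : PVal h Θ Γ V₁ V₂ (A ⟨l, hl⟩)) :
      PVal h Θ Γ (.inj l V₁) (.inj l V₂) (.variant L A)
  | thunk {h : Hole} {Θ : TyEnv} {Γ : Env} {E : Eff} {M₁ M₂ : Comp} {C : CTy}
      (j : JVal Θ Γ (.U E C)) (pM : PComp h Θ Γ E M₁ M₂ C) :
      PVal h Θ Γ (.thunk M₁) (.thunk M₂) (.U E C)
/-- The tuples `⟨Θ, Γ, E, N₁, N₂, C⟩` of contexts plugged with the two phrases of a hole. -/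
inductive PComp : Hole → TyEnv → Env → Eff → Comp → Comp → CTy → Prop
  | hole {Θ₀ Θ : TyEnv} {Γ₀ Γ : Env} {E : Eff} {M₁ M₂ : Comp} {C : CTy} {ρ : ℕ → ℕ}
      (j : JComp Θ Γ E C) (hΘ : Θ₀ ⊆ Θ) (hΓ : Extends Γ₀ Γ ρ) :
      PComp (.comp Θ₀ Γ₀ E M₁ M₂ C) Θ Γ E (M₁.rename ρ) (M₂.rename ρ) C
  | split {h : Hole} {Θ : TyEnv} {Γ : Env} {E : Eff} {V₁ V₂ : Val} {M₁ M₂ : Comp} {A B : VTy}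
      {C : CTy} (j : JComp Θ Γ E C) (pV : PVal h Θ Γ V₁ V₂ (.prod A B))
      (pM : PComp h Θ (B :: A :: Γ) E M₁ M₂ C) : PComp h Θ Γ E (.split V₁ M₁) (.split V₂ M₂) C
  | case {h : Hole} {Θ : TyEnv} {Γ : Env} {E : Eff} {V₁ V₂ : Val} {L : Finset ℕ}
      {M₁ M₂ : L → Comp} {A : L → VTy} {C : CTy} (j : JComp Θ Γ E C)
      (pV : PVal h Θ Γ V₁ V₂ (.variant L A))
      (pM : ∀ l : L, PComp h Θ (A l :: Γ) E (M₁ l) (M₂ l) C) :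
      PComp h Θ Γ E (.case V₁ L M₁) (.case V₂ L M₂) C
  | force {h : Hole} {Θ : TyEnv} {Γ : Env} {E : Eff} {V₁ V₂ : Val} {C : CTy}
      (j : JComp Θ Γ E C) (pV : PVal h Θ Γ V₁ V₂ (.U E C)) :
      PComp h Θ Γ E (.force V₁) (.force V₂) C
  | ret {h : Hole} {Θ : TyEnv} {Γ : Env} {E : Eff} {V₁ V₂ : Val} {A : VTy}
      (j : JComp Θ Γ E (.F A)) (pV : PVal h Θ Γ V₁ V₂ A) :
      PComp h Θ Γ E (.ret V₁) (.ret V₂) (.F A)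
  | seq {h : Hole} {Θ : TyEnv} {Γ : Env} {E : Eff} {M₁ M₂ N₁ N₂ : Comp} {A : VTy} {C : CTy}
      (j : JComp Θ Γ E C) (pM : PComp h Θ Γ E M₁ M₂ (.F A))
      (pN : PComp h Θ (A :: Γ) E N₁ N₂ C) : PComp h Θ Γ E (.seq M₁ N₁) (.seq M₂ N₂) C
  | lam {h : Hole} {Θ : TyEnv} {Γ : Env} {E : Eff} {M₁ M₂ : Comp} {A : VTy} {C : CTy}
      (j : JComp Θ Γ E (.fn A C)) (pM : PComp h Θ (A :: Γ) E M₁ M₂ C) :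
      PComp h Θ Γ E (.lam M₁) (.lam M₂) (.fn A C)
  | app {h : Hole} {Θ : TyEnv} {Γ : Env} {E : Eff} {M₁ M₂ : Comp} {V₁ V₂ : Val} {A : VTy}
      {C : CTy} (j : JComp Θ Γ E C) (pM : PComp h Θ Γ E M₁ M₂ (.fn A C))
      (pV : PVal h Θ Γ V₁ V₂ A) : PComp h Θ Γ E (.app M₁ V₁) (.app M₂ V₂) C
  | pair {h : Hole} {Θ : TyEnv} {Γ : Env} {E : Eff} {M₁ M₂ N₁ N₂ : Comp} {C D : CTy}
      (j : JComp Θ Γ E (.prod C D)) (pM : PComp h Θ Γ E M₁ M₂ C) (pN : PComp h Θ Γ E N₁ N₂ D) :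
      PComp h Θ Γ E (.pair M₁ N₁) (.pair M₂ N₂) (.prod C D)
  | prj1 {h : Hole} {Θ : TyEnv} {Γ : Env} {E : Eff} {M₁ M₂ : Comp} {C D : CTy}
      (j : JComp Θ Γ E C) (pM : PComp h Θ Γ E M₁ M₂ (.prod C D)) :
      PComp h Θ Γ E (.prj1 M₁) (.prj1 M₂) C
  | prj2 {h : Hole} {Θ : TyEnv} {Γ : Env} {E : Eff} {M₁ M₂ : Comp} {C D : CTy}
      (j : JComp Θ Γ E D) (pM : PComp h Θ Γ E M₁ M₂ (.prod C D)) :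
      PComp h Θ Γ E (.prj2 M₁) (.prj2 M₂) D
  | op {h : Hole} {Θ : TyEnv} {Γ : Env} {O : Finset ℕ} {P R : O → VTy} {o : ℕ} {V₁ V₂ : Val}
      (ho : o ∈ O) (j : JComp Θ Γ (.mk O P R) (.F (R ⟨o, ho⟩)))
      (pV : PVal h Θ Γ V₁ V₂ (P ⟨o, ho⟩)) :
      PComp h Θ Γ (.mk O P R) (.op o V₁) (.op o V₂) (.F (R ⟨o, ho⟩))
  | handle {h : Hole} {Θ : TyEnv} {Γ : Env} {E E' : Eff} {M₁ M₂ : Comp} {H₁ H₂ : Hdl} {A : VTy}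
      {C : CTy} (j : JComp Θ Γ E' C) (pM : PComp h Θ Γ E M₁ M₂ (.F A))
      (pH : PHdl h Θ Γ H₁ H₂ A E E' C) : PComp h Θ Γ E' (.handle M₁ H₁) (.handle M₂ H₂) C
/-- The tuples of handlers in contexts plugged with the two phrases of a hole. -/
inductive PHdl : Hole → TyEnv → Env → Hdl → Hdl → VTy → Eff → Eff → CTy → Prop
  | mk {h : Hole} {Θ : TyEnv} {Γ : Env} {N₁ N₂ : Comp} {O : Finset ℕ} {cl₁ cl₂ : O → Comp}
      {P R : O → VTy} {A : VTy} {E' : Eff} {C : CTy} (j : JHdl Θ Γ A (.mk O P R) E' C)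
      (pN : PComp h Θ (A :: Γ) E' N₁ N₂ C)
      (pcl : ∀ o : O, PComp h Θ (.U E' (.fn (R o) C) :: P o :: Γ) E' (cl₁ o) (cl₂ o) C) :
      PHdl h Θ Γ (.mk N₁ O cl₁) (.mk N₂ O cl₂) A (.mk O P R) E' C
end

/-- The two phrases of a hole are contextually equivalent: plugged into any closed pure context of
ground returner type, they return the same closed ground values. -/
def CtxEquiv (h : Hole) : Prop :=
  ∀ (G : VTy), Ground G → ∀ (M₁ M₂ : Comp), PComp h ∅ [] Eff.pure M₁ M₂ (.F G) →
    ∀ (V : Val), Nonempty (DVal ∅ [] V G) → (Steps M₁ (.ret V) ↔ Steps M₂ (.ret V))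

end LamEff

-- The proof uses a logical relation between elements of denotations and terms, defined by recursion
-- on types. A computation tree in a free algebra is related to `M` when `M` evaluates accordingly.
-- For a leaf, `M` reduces to a return of a related value. For a node, `M` reduces to a matching
-- operation call `K[op V]` such that each `K[return W]` is related to the corresponding subtree.
-- Functions and pairs are tested by applying and projecting, thunks by forcing. The relation is
-- closed under head expansion (`CTy.Rel.of_steps`) and under the operations of the algebras
-- (`CTy.Rel.opr`). With these facts sequencing (`CTy.Rel.seq`) and deep handling (`SemHdl.mk`)
-- follow by induction on the computation tree.
--
-- A term realizes a function `f` when, under related substitutions, it is related to the values of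
-- `f`. Every derivable term realizes its denotation, so two phrases with equal denotations realize
-- a common function. Realizing a common function is preserved by every typing rule
-- (`PComp.exists_sem`), hence the two sides of a plugged context realize one too, and no
-- derivations of the plugged terms have to be compared.
--
-- At a closed pure computation of ground returner type the common tree has no operation nodes, so
-- it is a leaf. Both sides therefore return values related to the same ground element, and these
-- coincide by `Ground.rel_unique`. As reduction is deterministic (`Steps.ret_unique`), this shared
-- value is the only one either side can return.

namespace LamEff

/-! ### Substitution -/

/-- The extension of a substitution by a value for index `0`. -/
def scons (V : Val) (σ : ℕ → Val) : ℕ → Val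
  | 0 => V
  | n + 1 => σ n

theorem sub1_eq (V : Val) : sub1 V = scons V .var := by
  funext n; cases n <;> rfl

theorem sub2_eq (V W : Val) : sub2 V W = scons W (scons V .var) := by
  funext n; rcases n with _ | _ | n <;> rfl

theorem ups_var : ups .var = .var := by
  funext n; cases n <;> rfl

theorem upr_comp (ρ ρ' : ℕ → ℕ) : (fun n => upr ρ' (upr ρ n)) = upr (fun n => ρ' (ρ n)) := by
  funext n; cases n <;> rfl

theorem ups_comp_upr (ρ : ℕ → ℕ) (σ : ℕ → Val) :
    (fun n => ups σ (upr ρ n)) = ups (fun n => σ (ρ n)) := by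
  funext n; cases n <;> rfl

mutual
theorem Val.subst_var : ∀ V : Val, V.subst .var = V
  | .var x => rfl
  | .unit => rfl
  | .pair V W => by simp only [Val.subst, V.subst_var, W.subst_var]
  | .inj l V => by simp only [Val.subst, V.subst_var]
  | .thunk M => by simp only [Val.subst, M.subst_var]
theorem Comp.subst_var : ∀ M : Comp, M.subst .var = M
  | .split V M => by simp only [Comp.subst, ups_var, V.subst_var, M.subst_var]
  | .case V L M => by simp only [Comp.subst, ups_var, V.subst_var, fun l => (M l).subst_var]
  | .force V => by simp only [Comp.subst, V.subst_var]
  | .ret V => by simp only [Comp.subst, V.subst_var]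
  | .seq M N => by simp only [Comp.subst, ups_var, M.subst_var, N.subst_var]
  | .lam M => by simp only [Comp.subst, ups_var, M.subst_var]
  | .app M V => by simp only [Comp.subst, M.subst_var, V.subst_var]
  | .pair M N => by simp only [Comp.subst, M.subst_var, N.subst_var]
  | .prj1 M => by simp only [Comp.subst, M.subst_var]
  | .prj2 M => by simp only [Comp.subst, M.subst_var]
  | .op o V => by simp only [Comp.subst, V.subst_var]
  | .handle M H => by simp only [Comp.subst, M.subst_var, H.subst_var]
theorem Hdl.subst_var : ∀ H : Hdl, H.subst .var = H
  | .mk N O cl => by simp only [Hdl.subst, ups_var, N.subst_var, fun o => (cl o).subst_var]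
end

mutual
theorem Val.rename_rename : ∀ (V : Val) (ρ ρ' : ℕ → ℕ),
    (V.rename ρ).rename ρ' = V.rename (fun n => ρ' (ρ n))
  | .var x, _, _ => rfl
  | .unit, _, _ => rfl
  | .pair V W, _, _ => by simp only [Val.rename, V.rename_rename, W.rename_rename]
  | .inj l V, _, _ => by simp only [Val.rename, V.rename_rename]
  | .thunk M, _, _ => by simp only [Val.rename, M.rename_rename]
theorem Comp.rename_rename : ∀ (M : Comp) (ρ ρ' : ℕ → ℕ),
    (M.rename ρ).rename ρ' = M.rename (fun n => ρ' (ρ n))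
  | .split V M, _, _ => by
    simp only [Comp.rename, V.rename_rename, M.rename_rename, upr_comp]
  | .case V L M, _, _ => by
    simp only [Comp.rename, V.rename_rename, fun l => (M l).rename_rename, upr_comp]
  | .force V, _, _ => by simp only [Comp.rename, V.rename_rename]
  | .ret V, _, _ => by simp only [Comp.rename, V.rename_rename]
  | .seq M N, _, _ => by simp only [Comp.rename, M.rename_rename, N.rename_rename, upr_comp]
  | .lam M, _, _ => by simp only [Comp.rename, M.rename_rename, upr_comp]
  | .app M V, _, _ => by simp only [Comp.rename, M.rename_rename, V.rename_rename]
  | .pair M N, _, _ => by simp only [Comp.rename, M.rename_rename, N.rename_rename]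
  | .prj1 M, _, _ => by simp only [Comp.rename, M.rename_rename]
  | .prj2 M, _, _ => by simp only [Comp.rename, M.rename_rename]
  | .op o V, _, _ => by simp only [Comp.rename, V.rename_rename]
  | .handle M H, _, _ => by simp only [Comp.rename, M.rename_rename, H.rename_rename]
theorem Hdl.rename_rename : ∀ (H : Hdl) (ρ ρ' : ℕ → ℕ),
    (H.rename ρ).rename ρ' = H.rename (fun n => ρ' (ρ n))
  | .mk N O cl, _, _ => by
    simp only [Hdl.rename, N.rename_rename, fun o => (cl o).rename_rename, upr_comp]
end

mutual
theorem Val.subst_rename : ∀ (V : Val) (ρ : ℕ → ℕ) (σ : ℕ → Val),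
    (V.rename ρ).subst σ = V.subst (fun n => σ (ρ n))
  | .var x, _, _ => rfl
  | .unit, _, _ => rfl
  | .pair V W, _, _ => by simp only [Val.rename, Val.subst, V.subst_rename, W.subst_rename]
  | .inj l V, _, _ => by simp only [Val.rename, Val.subst, V.subst_rename]
  | .thunk M, _, _ => by simp only [Val.rename, Val.subst, M.subst_rename]
theorem Comp.subst_rename : ∀ (M : Comp) (ρ : ℕ → ℕ) (σ : ℕ → Val),
    (M.rename ρ).subst σ = M.subst (fun n => σ (ρ n))
  | .split V M, _, _ => by
    simp only [Comp.rename, Comp.subst, V.subst_rename, M.subst_rename, ups_comp_upr]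
  | .case V L M, _, _ => by
    simp only [Comp.rename, Comp.subst, V.subst_rename, fun l => (M l).subst_rename, ups_comp_upr]
  | .force V, _, _ => by simp only [Comp.rename, Comp.subst, V.subst_rename]
  | .ret V, _, _ => by simp only [Comp.rename, Comp.subst, V.subst_rename]
  | .seq M N, _, _ => by
    simp only [Comp.rename, Comp.subst, M.subst_rename, N.subst_rename, ups_comp_upr]
  | .lam M, _, _ => by simp only [Comp.rename, Comp.subst, M.subst_rename, ups_comp_upr]
  | .app M V, _, _ => by simp only [Comp.rename, Comp.subst, M.subst_rename, V.subst_rename]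
  | .pair M N, _, _ => by simp only [Comp.rename, Comp.subst, M.subst_rename, N.subst_rename]
  | .prj1 M, _, _ => by simp only [Comp.rename, Comp.subst, M.subst_rename]
  | .prj2 M, _, _ => by simp only [Comp.rename, Comp.subst, M.subst_rename]
  | .op o V, _, _ => by simp only [Comp.rename, Comp.subst, V.subst_rename]
  | .handle M H, _, _ => by simp only [Comp.rename, Comp.subst, M.subst_rename, H.subst_rename]
theorem Hdl.subst_rename : ∀ (H : Hdl) (ρ : ℕ → ℕ) (σ : ℕ → Val),
    (H.rename ρ).subst σ = H.subst (fun n => σ (ρ n))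
  | .mk N O cl, _, _ => by
    simp only [Hdl.rename, Hdl.subst, N.subst_rename, fun o => (cl o).subst_rename, ups_comp_upr]
end

/-- At a successor index both sides rename `σ n` twice, and fusing renamings identifies them. This
binder case is why the rename-rename law has to come before `Val.rename_subst`. -/
theorem rename_upr_ups (σ : ℕ → Val) (ρ : ℕ → ℕ) :
    (fun n => (ups σ n).rename (upr ρ)) = ups (fun n => (σ n).rename ρ) := by
  funext n
  cases n with
  | zero => rfl
  | succ n => simp only [ups, Val.rename_rename]; rfl

mutual
theorem Val.rename_subst : ∀ (V : Val) (σ : ℕ → Val) (ρ : ℕ → ℕ),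
    (V.subst σ).rename ρ = V.subst (fun n => (σ n).rename ρ)
  | .var x, _, _ => rfl
  | .unit, _, _ => rfl
  | .pair V W, _, _ => by simp only [Val.rename, Val.subst, V.rename_subst, W.rename_subst]
  | .inj l V, _, _ => by simp only [Val.rename, Val.subst, V.rename_subst]
  | .thunk M, _, _ => by simp only [Val.rename, Val.subst, M.rename_subst]
theorem Comp.rename_subst : ∀ (M : Comp) (σ : ℕ → Val) (ρ : ℕ → ℕ),
    (M.subst σ).rename ρ = M.subst (fun n => (σ n).rename ρ)
  | .split V M, _, _ => by
    simp only [Comp.rename, Comp.subst, V.rename_subst, M.rename_subst, rename_upr_ups]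
  | .case V L M, _, _ => by
    simp only [Comp.rename, Comp.subst, V.rename_subst, fun l => (M l).rename_subst,
      rename_upr_ups]
  | .force V, _, _ => by simp only [Comp.rename, Comp.subst, V.rename_subst]
  | .ret V, _, _ => by simp only [Comp.rename, Comp.subst, V.rename_subst]
  | .seq M N, _, _ => by
    simp only [Comp.rename, Comp.subst, M.rename_subst, N.rename_subst, rename_upr_ups]
  | .lam M, _, _ => by simp only [Comp.rename, Comp.subst, M.rename_subst, rename_upr_ups]
  | .app M V, _, _ => by simp only [Comp.rename, Comp.subst, M.rename_subst, V.rename_subst]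
  | .pair M N, _, _ => by simp only [Comp.rename, Comp.subst, M.rename_subst, N.rename_subst]
  | .prj1 M, _, _ => by simp only [Comp.rename, Comp.subst, M.rename_subst]
  | .prj2 M, _, _ => by simp only [Comp.rename, Comp.subst, M.rename_subst]
  | .op o V, _, _ => by simp only [Comp.rename, Comp.subst, V.rename_subst]
  | .handle M H, _, _ => by simp only [Comp.rename, Comp.subst, M.rename_subst, H.rename_subst]
theorem Hdl.rename_subst : ∀ (H : Hdl) (σ : ℕ → Val) (ρ : ℕ → ℕ),
    (H.subst σ).rename ρ = H.subst (fun n => (σ n).rename ρ)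
  | .mk N O cl, _, _ => by
    simp only [Hdl.rename, Hdl.subst, N.rename_subst, fun o => (cl o).rename_subst,
      rename_upr_ups]
end

/-- Both mixed laws are consumed here: one absorbs the weakening made by `ups σ`, the other the
weakening made by `ups τ`. -/
theorem subst_ups_ups (σ τ : ℕ → Val) :
    (fun n => (ups σ n).subst (ups τ)) = ups (fun n => (σ n).subst τ) := by
  funext n
  cases n with
  | zero => rfl
  | succ n => simp only [ups, Val.subst_rename, Val.rename_subst]

mutual
theorem Val.subst_subst : ∀ (V : Val) (σ τ : ℕ → Val),
    (V.subst σ).subst τ = V.subst (fun n => (σ n).subst τ)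
  | .var x, _, _ => rfl
  | .unit, _, _ => rfl
  | .pair V W, _, _ => by simp only [Val.subst, V.subst_subst, W.subst_subst]
  | .inj l V, _, _ => by simp only [Val.subst, V.subst_subst]
  | .thunk M, _, _ => by simp only [Val.subst, M.subst_subst]
theorem Comp.subst_subst : ∀ (M : Comp) (σ τ : ℕ → Val),
    (M.subst σ).subst τ = M.subst (fun n => (σ n).subst τ)
  | .split V M, _, _ => by
    simp only [Comp.subst, V.subst_subst, M.subst_subst, subst_ups_ups]
  | .case V L M, _, _ => by
    simp only [Comp.subst, V.subst_subst, fun l => (M l).subst_subst, subst_ups_ups]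
  | .force V, _, _ => by simp only [Comp.subst, V.subst_subst]
  | .ret V, _, _ => by simp only [Comp.subst, V.subst_subst]
  | .seq M N, _, _ => by simp only [Comp.subst, M.subst_subst, N.subst_subst, subst_ups_ups]
  | .lam M, _, _ => by simp only [Comp.subst, M.subst_subst, subst_ups_ups]
  | .app M V, _, _ => by simp only [Comp.subst, M.subst_subst, V.subst_subst]
  | .pair M N, _, _ => by simp only [Comp.subst, M.subst_subst, N.subst_subst]
  | .prj1 M, _, _ => by simp only [Comp.subst, M.subst_subst]
  | .prj2 M, _, _ => by simp only [Comp.subst, M.subst_subst]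
  | .op o V, _, _ => by simp only [Comp.subst, V.subst_subst]
  | .handle M H, _, _ => by simp only [Comp.subst, M.subst_subst, H.subst_subst]
theorem Hdl.subst_subst : ∀ (H : Hdl) (σ τ : ℕ → Val),
    (H.subst σ).subst τ = H.subst (fun n => (σ n).subst τ)
  | .mk N O cl, _, _ => by
    simp only [Hdl.subst, N.subst_subst, fun o => (cl o).subst_subst, subst_ups_ups]
end

-- Cancellation laws for the substitutions created by β-reduction.

theorem Val.rename_succ_subst_scons (V W : Val) (σ : ℕ → Val) :
    (V.rename Nat.succ).subst (scons W σ) = V.subst σ :=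
  V.subst_rename _ _

theorem subst_ups_scons (σ τ : ℕ → Val) (V : Val) :
    (fun n => (ups σ n).subst (scons V τ)) = scons V (fun n => (σ n).subst τ) := by
  funext n
  cases n with
  | zero => rfl
  | succ n => exact Val.rename_succ_subst_scons _ _ _

/-- A β-step on a term already instantiated by `σ` merely extends `σ` by the argument. This is the
shape that realizability under a binder requires. -/
theorem Comp.subst_ups_sub1 (M : Comp) (σ : ℕ → Val) (V : Val) :
    (M.subst (ups σ)).subst (sub1 V) = M.subst (scons V σ) := by
  simp only [sub1_eq, Comp.subst_subst, subst_ups_scons, Val.subst_var]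

theorem Comp.subst_ups_sub2 (M : Comp) (σ : ℕ → Val) (V W : Val) :
    (M.subst (ups (ups σ))).subst (sub2 V W) = M.subst (scons W (scons V σ)) := by
  simp only [sub2_eq, Comp.subst_subst, subst_ups_scons, Val.subst_var]

theorem ups_sub1_upr_succ (V : Val) : (fun n => ups (sub1 V) (upr Nat.succ n)) = .var := by
  rw [ups_comp_upr]; exact ups_var

theorem Comp.rename_succ_sub1 (M : Comp) (V : Val) : (M.rename Nat.succ).subst (sub1 V) = M := by
  rw [Comp.subst_rename]; exact M.subst_var

theorem Val.rename_succ_sub1 (W V : Val) : (W.rename Nat.succ).subst (sub1 V) = W := by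
  rw [Val.subst_rename]; exact W.subst_var

theorem Hdl.rename_succ_sub1 (H : Hdl) (V : Val) : (H.rename Nat.succ).subst (sub1 V) = H := by
  rw [Hdl.subst_rename]; exact H.subst_var

theorem BFrame.rename_succ_plug_sub1 (B : BFrame) (M : Comp) (V : Val) :
    ((B.rename Nat.succ).plug M).subst (sub1 V) = B.plug (M.subst (sub1 V)) := by
  cases B <;>
    simp only [BFrame.rename, BFrame.plug, Comp.subst, Comp.subst_rename, ups_sub1_upr_succ,
      Comp.subst_var, Val.rename_succ_sub1]

/-- The continuation captured by a handler weakens `K` to avoid its bound variable. Applying the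
continuation undoes that weakening and fills only the hole. -/
theorem HCtx.rename_succ_plug_sub1 (K : HCtx) (M : Comp) (V : Val) :
    ((HCtx.rename K Nat.succ).plug M).subst (sub1 V) = HCtx.plug K (M.subst (sub1 V)) := by
  induction K with
  | nil => rfl
  | cons B K ih => exact (B.rename_succ_plug_sub1 _ V).trans (congrArg B.plug ih)

/-! ### Reduction -/

theorem Beta.step {M N : Comp} (h : Beta M N) : Step M N := Step.mk [] h

theorem Step.plug {M N : Comp} (F : Frame) (h : Step M N) : Step (F.plug M) (F.plug N) := by
  cases h with
  | mk K h => exact Step.mk (F :: K) h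

theorem Steps.plug {M N : Comp} (F : Frame) (h : Steps M N) : Steps (F.plug M) (F.plug N) :=
  Relation.ReflTransGen.lift F.plug (fun _ _ => Step.plug F) _ _ h

theorem Steps.beta {M N P : Comp} (h : Steps M N) (b : Beta N P) : Steps M P :=
  Relation.ReflTransGen.tail h b.step

theorem Beta.steps {M N : Comp} (h : Beta M N) : Steps M N := Relation.ReflTransGen.single h.step

-- Determinism of reduction.

/-- The decomposition of a computation as an operation call in a hoisting context. -/
def Comp.call : Comp → Option (HCtx × ℕ × Val)
  | .op o V => some ([], o, V)
  | .seq M N => M.call.map fun p => (.seq N :: p.1, p.2)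
  | .app M V => M.call.map fun p => (.app V :: p.1, p.2)
  | .prj1 M => M.call.map fun p => (.prj1 :: p.1, p.2)
  | .prj2 M => M.call.map fun p => (.prj2 :: p.1, p.2)
  | _ => none

/-- The result of handling an operation call. -/
def Hdl.call : Hdl → HCtx × ℕ × Val → Option Comp
  | .mk N O cl, p =>
    if ho : p.2.1 ∈ O then
      some ((cl ⟨p.2.1, ho⟩).subst (sub2 p.2.2 (.thunk (.lam
          (.handle ((HCtx.rename p.1 Nat.succ).plug (.ret (.var 0)))
            ((Hdl.mk N O cl).rename Nat.succ))))))
    else none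

/-- The reduct of a handled value. -/
def Hdl.onRet : Hdl → Val → Comp
  | .mk N _ _, V => N.subst (sub1 V)

/-- One-step reduction as a partial function. -/
def Comp.next : Comp → Option Comp
  | .split (.pair V W) M => some (M.subst (sub2 V W))
  | .case (.inj l V) L M => if hl : l ∈ L then some ((M ⟨l, hl⟩).subst (sub1 V)) else none
  | .force (.thunk M) => some M
  | .seq M N => match M with
    | .ret V => some (N.subst (sub1 V))
    | M => M.next.map fun M' => .seq M' N
  | .app M V => match M with
    | .lam M => some (M.subst (sub1 V))
    | M => M.next.map fun M' => .app M' V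
  | .prj1 M => match M with
    | .pair M _ => some M
    | M => M.next.map .prj1
  | .prj2 M => match M with
    | .pair _ N => some N
    | M => M.next.map .prj2
  | .handle M H => match M with
    | .ret V => some (H.onRet V)
    | M => match M.next with
      | some M' => some (.handle M' H)
      | none => M.call.bind H.call
  | _ => none

theorem BFrame.call_plug (B : BFrame) {M : Comp} {p : HCtx × ℕ × Val} (h : M.call = some p) :
    (B.plug M).call = some (B :: p.1, p.2) := by
  cases B <;> simp only [BFrame.plug, Comp.call, h, Option.map_some]

/-- A term with a call decomposition is never an introduction form, so the frame has no β-redex of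
its own and the only possible step would be one of `M`. -/
theorem BFrame.next_plug_eq_none (B : BFrame) {M : Comp} {p : HCtx × ℕ × Val}
    (h : M.call = some p) (hn : M.next = none) : (B.plug M).next = none := by
  cases B <;> cases M <;>
    first
    | (cases h; done)
    | exact congrArg (Option.map _) hn

theorem Comp.next_handle_of_call {M : Comp} {p : HCtx × ℕ × Val} (H : Hdl)
    (h : M.call = some p) (hn : M.next = none) : (M.handle H).next = H.call p := by
  have : (M.handle H).next = match M.next with
      | some M' => some (.handle M' H)
      | none => M.call.bind H.call := by
    cases M <;> first | rfl | cases h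
  rw [this, hn, h]
  rfl

/-- Reading `K`, `o` and `V` back off the plugged term shows that the decomposition is unique, so
the handler rule for operations has only one possible reduct. -/
theorem HCtx.call_plug (K : HCtx) (o : ℕ) (V : Val) :
    (HCtx.plug K (.op o V)).call = some (K, o, V) := by
  induction K with
  | nil => rfl
  | cons B K ih => exact B.call_plug ih

theorem HCtx.next_plug (K : HCtx) (o : ℕ) (V : Val) : (HCtx.plug K (.op o V)).next = none := by
  induction K with
  | nil => rfl
  | cons B K ih => exact B.next_plug_eq_none (HCtx.call_plug K o V) ih

/-- A reducible `M` is not an introduction form, so `F` cannot consume it and the step is taken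
inside the frame. -/
theorem Frame.next_plug {M N : Comp} (F : Frame) (h : M.next = some N) :
    (F.plug M).next = some (F.plug N) := by
  rcases F with (B | _ | _ | _) | H <;> cases M <;>
    simp_all [Frame.plug, BFrame.plug, Comp.next]

theorem Beta.next {M N : Comp} (h : Beta M N) : M.next = some N := by
  cases h with
  | handleOp K o V N O cl ho =>
    rw [Comp.next_handle_of_call _ (HCtx.call_plug K o V) (HCtx.next_plug K o V)]
    exact dif_pos ho
  | _ => simp_all [Comp.next, Hdl.onRet]

theorem Step.next {M N : Comp} (h : Step M N) : M.next = some N := by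
  cases h with
  | mk K h =>
    induction K with
    | nil => exact h.next
    | cons F K ih => exact F.next_plug ih

/-- Since `Comp.next` makes steps functional, one of the two reduction sequences extends the other,
and a return does not reduce further. -/
theorem Steps.ret_unique {M : Comp} {V W : Val} (hV : Steps M (.ret V)) (hW : Steps M (.ret W)) :
    V = W := by
  have hu : Relator.RightUnique Step := fun M N P hN hP =>
    Option.some.inj (hN.next.symm.trans hP.next)
  have hn : ∀ {V W : Val}, Steps (.ret V) (.ret W) → V = W := fun h => by
    rcases Relation.ReflTransGen.cases_head h with h | ⟨_, h, -⟩
    · exact Comp.ret.inj h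
    · cases h.next
  rcases Relation.ReflTransGen.total_of_right_unique hu hV hW with h | h
  · exact hn h
  · exact (hn h).symm

/-! ### Algebras -/

/-- The interpretation of an operation symbol in an algebra. -/
def AlgStr.opr {S : Sig.{u}} {X : Type u} (c : AlgStr S X) (f : S.Sym) (t : S.ar f → X) : X :=
  c.str (.op f (fun a => .ret (t a)))

theorem AlgStr.ext_ret {S : Sig.{u}} {X Y : Type u} (c : AlgStr S Y) (f : X → Y) (x : X) :
    c.ext f (.ret x) = f x :=
  c.str_ret (f x)

theorem AlgStr.ext_op {S : Sig.{u}} {X Y : Type u} (c : AlgStr S Y) (f : X → Y) (g : S.Sym)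
    (t : S.ar g → Free S X) : c.ext f (.op g t) = c.opr g (fun a => c.ext f (t a)) :=
  -- Associativity is applied to a one-layer term of terms: flattening it gives the mapped tree,
  -- evaluating its leaves first gives the operation on the recursive results.
  (c.str_fmap (.op g (fun a => .ret ((t a).fmap f)))).symm

/-! ### The logical relation -/

/-- Relations between the operation symbols, respectively the elements of their arities, and
syntax. -/
structure SigRel (S : Sig.{u}) where
  sym : S.Sym → ℕ → Val → Prop
  ar : ∀ f : S.Sym, S.ar f → Val → Prop

/-- The lifting of a relation between elements of `X` and values to `S`-terms over `X` and
computations. -/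
def Free.Rel {S : Sig.{u}} (e : SigRel S) {X : Type u} (r : X → Val → Prop) :
    Free S X → Comp → Prop
  | .ret x, M => ∃ V, Steps M (.ret V) ∧ r x V
  | .op f t, M => ∃ (K : HCtx) (o : ℕ) (V : Val), Steps M (K.plug (.op o V)) ∧ e.sym f o V ∧
      ∀ a W, e.ar f a W → (t a).Rel e r (K.plug (.ret W))

mutual
/-- The relation between elements of the denotation of a value type and values. -/
def VTy.Rel (θ : TyAssign.{u}) : (A : VTy) → A.sem θ → Val → Prop
  -- No rule inspects an element of a type variable, so any relation would do here.
  | .tvar _, _, _ => False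
  | .unit, _, V => V = .unit
  | .prod A B, x, V => ∃ V₁ V₂, V = .pair V₁ V₂ ∧ A.Rel θ x.1 V₁ ∧ B.Rel θ x.2 V₂
  | .variant _ A, x, V => ∃ W, V = .inj x.1 W ∧ (A x.1).Rel θ x.2 W
  -- `E` is a component of the type only at this point. Passing its relations on as a parameter
  -- keeps the recursion through `C` structural.
  | .U E C, x, V => C.Rel θ E
      { sym := fun f o W => E.SymRel θ f o W, ar := fun f a W => E.ArRel θ f a W } x (.force V)
/-- The relation between elements of the denotation of a computation type and computations. -/
def CTy.Rel (θ : TyAssign.{u}) : (C : CTy) → (E : Eff) → SigRel (E.sem θ) → C.car θ E →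
    Comp → Prop
  | .F A, _, e, x, M => Free.Rel e (fun a V => A.Rel θ a V) x M
  | .fn A C, E, e, f, M => ∀ a V, A.Rel θ a V → C.Rel θ E e (f a) (.app M V)
  | .prod C D, E, e, x, M => C.Rel θ E e x.1 (.prj1 M) ∧ D.Rel θ E e x.2 (.prj2 M)
/-- The relation between operation symbols and operation names applied to parameters. -/
def Eff.SymRel (θ : TyAssign.{u}) : (E : Eff) → (E.sem θ).Sym → ℕ → Val → Prop
  | .mk _ P _, f, o, V => o = f.1 ∧ (P f.1).Rel θ f.2 V
/-- The relation between elements of arities and values. -/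
def Eff.ArRel (θ : TyAssign.{u}) : (E : Eff) → (f : (E.sem θ).Sym) → (E.sem θ).ar f → Val → Prop
  | .mk _ _ R, f, a, W => (R f.1).Rel θ a W
end

/-- The relations of the signature denoted by an effect annotation. -/
def Eff.Rel (θ : TyAssign.{u}) (E : Eff) : SigRel (E.sem θ) where
  sym := E.SymRel θ
  ar := E.ArRel θ

variable {θ : TyAssign.{u}}

/-- The relation speaks of `M` only through what `M` reduces to, so it can be pulled back along
reduction. -/
theorem Free.Rel.of_steps {S : Sig.{u}} {e : SigRel S} {X : Type u} {r : X → Val → Prop}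
    {t : Free S X} {M N : Comp} (h : Steps M N) (hN : t.Rel e r N) : t.Rel e r M := by
  cases t with
  | ret x =>
    obtain ⟨V, hV, hx⟩ := hN
    exact ⟨V, h.trans hV, hx⟩
  | op f t =>
    obtain ⟨K, o, V, hV, hK⟩ := hN
    exact ⟨K, o, V, h.trans hV, hK⟩

theorem CTy.Rel.of_steps {E : Eff} {e : SigRel (E.sem θ)} : ∀ {C : CTy} {x : C.car θ E}
    {M N : Comp}, Steps M N → C.Rel θ E e x N → C.Rel θ E e x M
  | .F _, _, _, _, h, hN =>
    Free.Rel.of_steps h hN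
  | .fn _ _, _, _, _, h, hN =>
    fun a V hV => CTy.Rel.of_steps (h.plug (.basic (.app V))) (hN a V hV)
  | .prod _ _, _, _, _, h, hN =>
    ⟨CTy.Rel.of_steps (h.plug (.basic .prj1)) hN.1,
      CTy.Rel.of_steps (h.plug (.basic .prj2)) hN.2⟩

theorem CTy.Rel.of_beta {E : Eff} {e : SigRel (E.sem θ)} {C : CTy} {x : C.car θ E}
    {M N : Comp} (h : Beta M N) (hN : C.Rel θ E e x N) : C.Rel θ E e x M :=
  hN.of_steps h.steps

/-- The relation is closed under the operations. -/
theorem CTy.Rel.opr {E : Eff} {e : SigRel (E.sem θ)} {f : (E.sem θ).Sym} {o : ℕ} {V : Val}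
    (hV : e.sym f o V) : ∀ {C : CTy} {t : (E.sem θ).ar f → C.car θ E} {M : Comp} {K : HCtx},
    Steps M (HCtx.plug K (.op o V)) →
    (∀ a W, e.ar f a W → C.Rel θ E e (t a) (HCtx.plug K (.ret W))) →
    C.Rel θ E e ((C.sem θ (E.sem θ)).alg.opr f t) M
  -- In the free algebra the operation is by computation the node itself, and the assumptions are
  -- exactly the clause of the relation at a node.
  | .F _, _, _, _, h, hN =>
    ⟨_, _, _, h, hV, hN⟩
  -- The operation is computed pointwise, and the testing frame is absorbed into the hoisting
  -- context. This is why `K` is arbitrary.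
  | .fn _ C, t, _, K, h, hN =>
    fun x W hW => CTy.Rel.opr hV (C := C) (t := fun a => t a x) (K := .app W :: K)
      (h.plug (.basic (.app W))) (fun a U hU => hN a U hU x W hW)
  | .prod C D, t, _, K, h, hN =>
    ⟨CTy.Rel.opr hV (C := C) (t := fun a => (t a).1) (K := .prj1 :: K)
        (h.plug (.basic .prj1)) (fun a U hU => (hN a U hU).1),
      CTy.Rel.opr hV (C := D) (t := fun a => (t a).2) (K := .prj2 :: K)
        (h.plug (.basic .prj2)) (fun a U hU => (hN a U hU).2)⟩

/-- Induction on the tree: a leaf triggers the β-rule for sequencing, while a node stays a call in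
the context enlarged by the `seq` frame and is covered by `CTy.Rel.opr`. -/
theorem CTy.Rel.seq {E : Eff} {e : SigRel (E.sem θ)} {C : CTy} {X : Type u} {r : X → Val → Prop}
    {f : X → C.car θ E} {N : Comp}
    (hN : ∀ a V, r a V → C.Rel θ E e (f a) (N.subst (sub1 V))) {t : Free (E.sem θ) X} {M : Comp}
    (hM : t.Rel e r M) : C.Rel θ E e ((C.sem θ (E.sem θ)).alg.ext f t) (.seq M N) := by
  induction t generalizing M with
  | ret a =>
    obtain ⟨V, h, hV⟩ := hM
    rw [AlgStr.ext_ret]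
    exact (hN a V hV).of_steps ((h.plug (.basic (.seq N))).beta (.seq V N))
  | op g t ih =>
    obtain ⟨K, o, V, h, hV, hK⟩ := hM
    rw [AlgStr.ext_op]
    exact CTy.Rel.opr hV (K := .seq N :: K) (h.plug (.basic (.seq N)))
      (fun a W hW => ih a (hK a W hW))

/-! ### Semantic typing -/

variable (θ) in
/-- The relation between elements of the denotation of an environment and substitutions. -/
def Env.Rel (Γ : Env) (γ : Env.sem θ Γ) (σ : ℕ → Val) : Prop :=
  ∀ (x : ℕ) (A : VTy) (h : Lookup Γ x A), A.Rel θ (h.sem θ γ) (σ x)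

theorem Env.Rel.cons {Γ : Env} {γ : Env.sem θ Γ} {σ : ℕ → Val} (h : Env.Rel θ Γ γ σ) {A : VTy}
    {a : A.sem θ} {V : Val} (hV : A.Rel θ a V) : Env.Rel θ (A :: Γ) (a, γ) (scons V σ) := by
  intro x B l
  cases l with
  | zero => exact hV
  | succ l => exact h _ _ l

/-- The value `V` realizes the function `f`. -/
def SemVal (Γ : Env) (V : Val) (A : VTy) (f : Env.sem θ Γ → A.sem θ) : Prop :=
  ∀ γ σ, Env.Rel θ Γ γ σ → A.Rel θ (f γ) (V.subst σ)

/-- The computation `M` realizes the function `f`. -/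
def SemComp (Γ : Env) (E : Eff) (M : Comp) (C : CTy) (f : Env.sem θ Γ → C.car θ E) : Prop :=
  ∀ γ σ, Env.Rel θ Γ γ σ → C.Rel θ E (E.Rel θ) (f γ) (M.subst σ)

/-- The handler `H` realizes the function `f`. -/
def SemHdl (Γ : Env) (H : Hdl) (A : VTy) (E E' : Eff) (C : CTy)
    (f : Env.sem θ Γ → HdlSem θ A E E' C) : Prop :=
  ∀ γ σ, Env.Rel θ Γ γ σ → ∀ (t : Free (E.sem θ) (A.sem θ)) (M : Comp),
    t.Rel (E.Rel θ) (fun a V => A.Rel θ a V) M →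
      C.Rel θ E' (E'.Rel θ) ((f γ).1.ext (f γ).2 t) (.handle M (H.subst σ))

section
variable {Γ : Env} {E E' : Eff} {A B : VTy} {C D : CTy} {V W : Val} {M N : Comp}

theorem SemVal.var {x : ℕ} (h : Lookup Γ x A) : SemVal Γ (.var x) A (h.sem θ) :=
  fun _ _ hγ => hγ x A h

theorem SemVal.unit : SemVal (θ := θ) Γ .unit .unit (fun _ => PUnit.unit) := by
  intro γ σ _
  rfl

theorem SemVal.pair {f : Env.sem θ Γ → A.sem θ} {g : Env.sem θ Γ → B.sem θ}
    (hV : SemVal Γ V A f) (hW : SemVal Γ W B g) :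
    SemVal Γ (.pair V W) (.prod A B) (fun γ => (f γ, g γ)) := by
  intro γ σ hγ
  exact ⟨_, _, rfl, hV γ σ hγ, hW γ σ hγ⟩

theorem SemVal.inj {L : Finset ℕ} {A : L → VTy} (l : L) {f : Env.sem θ Γ → (A l).sem θ}
    (hV : SemVal Γ V (A l) f) : SemVal Γ (.inj l V) (.variant L A) (fun γ => ⟨l, f γ⟩) := by
  intro γ σ hγ
  exact ⟨_, rfl, hV γ σ hγ⟩

theorem SemVal.thunk {f : Env.sem θ Γ → C.car θ E} (hM : SemComp Γ E M C f) :
    SemVal Γ (.thunk M) (.U E C) f := by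
  intro γ σ hγ
  exact (hM γ σ hγ).of_beta (.force _)

theorem SemComp.split {f : Env.sem θ Γ → A.sem θ × B.sem θ}
    {g : Env.sem θ (B :: A :: Γ) → C.car θ E} (hV : SemVal Γ V (.prod A B) f)
    (hM : SemComp (B :: A :: Γ) E M C g) :
    SemComp Γ E (.split V M) C (fun γ => g ((f γ).2, (f γ).1, γ)) := by
  intro γ σ hγ
  have h := hV γ σ hγ
  obtain ⟨V₁, V₂, hVe, h₁, h₂⟩ := h
  simp only [Comp.subst, hVe]
  refine CTy.Rel.of_beta (.split _ _ _) ?_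
  rw [Comp.subst_ups_sub2]
  exact hM _ _ ((hγ.cons h₁).cons h₂)

theorem SemComp.case {L : Finset ℕ} {A : L → VTy} {M : L → Comp}
    {f : Env.sem θ Γ → Σ l : L, (A l).sem θ} {g : ∀ l : L, Env.sem θ (A l :: Γ) → C.car θ E}
    (hV : SemVal Γ V (.variant L A) f) (hM : ∀ l, SemComp (A l :: Γ) E (M l) C (g l)) :
    SemComp Γ E (.case V L M) C (fun γ => g (f γ).1 ((f γ).2, γ)) := by
  intro γ σ hγ
  have h := hV γ σ hγ
  obtain ⟨W, hVe, h⟩ := h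
  simp only [Comp.subst, hVe]
  refine CTy.Rel.of_beta (.case _ _ _ _ (f γ).1.2) ?_
  rw [Comp.subst_ups_sub1]
  exact hM _ _ _ (hγ.cons h)

theorem SemComp.force {f : Env.sem θ Γ → C.car θ E} (hV : SemVal Γ V (.U E C) f) :
    SemComp Γ E (.force V) C f := by
  intro γ σ hγ
  have h := hV γ σ hγ
  exact h

theorem SemComp.ret {f : Env.sem θ Γ → A.sem θ} (hV : SemVal Γ V A f) :
    SemComp Γ E (.ret V) (.F A) (fun γ => Free.ret (f γ)) := by
  intro γ σ hγ
  exact ⟨_, Relation.ReflTransGen.refl, hV γ σ hγ⟩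

theorem SemComp.seq {f : Env.sem θ Γ → Free (E.sem θ) (A.sem θ)}
    {g : Env.sem θ (A :: Γ) → C.car θ E} (hM : SemComp Γ E M (.F A) f)
    (hN : SemComp (A :: Γ) E N C g) :
    SemComp Γ E (.seq M N) C
      (fun γ => (C.sem θ (E.sem θ)).alg.ext (fun a => g (a, γ)) (f γ)) := by
  intro γ σ hγ
  have h := hM γ σ hγ
  refine CTy.Rel.seq (fun a V hV => ?_) h
  rw [Comp.subst_ups_sub1]
  exact hN _ _ (hγ.cons hV)

theorem SemComp.lam {f : Env.sem θ (A :: Γ) → C.car θ E} (hM : SemComp (A :: Γ) E M C f) :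
    SemComp Γ E (.lam M) (.fn A C) (fun γ a => f (a, γ)) := by
  intro γ σ hγ a V hV
  refine CTy.Rel.of_beta (.app _ _) ?_
  rw [Comp.subst_ups_sub1]
  exact hM _ _ (hγ.cons hV)

theorem SemComp.app {f : Env.sem θ Γ → A.sem θ → C.car θ E} {g : Env.sem θ Γ → A.sem θ}
    (hM : SemComp Γ E M (.fn A C) f) (hV : SemVal Γ V A g) :
    SemComp Γ E (.app M V) C (fun γ => f γ (g γ)) := by
  intro γ σ hγ
  have h := hM γ σ hγ
  exact h _ _ (hV γ σ hγ)

theorem SemComp.pair {f : Env.sem θ Γ → C.car θ E} {g : Env.sem θ Γ → D.car θ E}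
    (hM : SemComp Γ E M C f) (hN : SemComp Γ E N D g) :
    SemComp Γ E (.pair M N) (.prod C D) (fun γ => (f γ, g γ)) := by
  intro γ σ hγ
  exact ⟨(hM γ σ hγ).of_beta (.prj1 _ _), (hN γ σ hγ).of_beta (.prj2 _ _)⟩

theorem SemComp.prj1 {f : Env.sem θ Γ → C.car θ E × D.car θ E}
    (hM : SemComp Γ E M (.prod C D) f) : SemComp Γ E (.prj1 M) C (fun γ => (f γ).1) := by
  intro γ σ hγ
  have h := hM γ σ hγ
  exact h.1

theorem SemComp.prj2 {f : Env.sem θ Γ → C.car θ E × D.car θ E}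
    (hM : SemComp Γ E M (.prod C D) f) : SemComp Γ E (.prj2 M) D (fun γ => (f γ).2) := by
  intro γ σ hγ
  have h := hM γ σ hγ
  exact h.2

theorem SemComp.op {O : Finset ℕ} {P R : O → VTy} (o : O) {f : Env.sem θ Γ → (P o).sem θ}
    (hV : SemVal Γ V (P o) f) :
    SemComp Γ (.mk O P R) (.op o V) (.F (R o))
      (fun γ => Free.op (S := (Eff.mk O P R).sem θ) ⟨o, f γ⟩ (fun a => Free.ret a)) := by
  intro γ σ hγ
  refine ⟨[], o, V.subst σ, Relation.ReflTransGen.refl, ?_, ?_⟩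
  · exact ⟨rfl, hV γ σ hγ⟩
  · intro a W hW
    exact ⟨W, Relation.ReflTransGen.refl, hW⟩

theorem SemComp.handle {H : Hdl} {f : Env.sem θ Γ → Free (E.sem θ) (A.sem θ)}
    {g : Env.sem θ Γ → HdlSem θ A E E' C} (hM : SemComp Γ E M (.F A) f)
    (hH : SemHdl Γ H A E E' C g) :
    SemComp Γ E' (.handle M H) C (fun γ => (g γ).1.ext (g γ).2 (f γ)) := by
  intro γ σ hγ
  have h := hM γ σ hγ
  exact hH γ σ hγ _ _ h

/-- Extension along the handler's algebra is a fold over the tree, and deep handling performs the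
same fold operationally, by handling each resumed continuation again. Hence induction on the tree.
-/
theorem SemHdl.mk {O : Finset ℕ} {P R : O → VTy} {cl : O → Comp}
    {f : Env.sem θ (A :: Γ) → C.car θ E'}
    {g : ∀ o : O, Env.sem θ (.U E' (.fn (R o) C) :: P o :: Γ) → C.car θ E'}
    (hN : SemComp (A :: Γ) E' N C f)
    (hcl : ∀ o, SemComp (.U E' (.fn (R o) C) :: P o :: Γ) E' (cl o) C (g o)) :
    SemHdl Γ (.mk N O cl) A (.mk O P R) E' C
      (fun γ => (AlgStr.ofOps (S := (Eff.mk O P R).sem θ) (fun s k => g s.1 (k, s.2, γ)),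
        fun a => f (a, γ))) := by
  intro γ σ hγ t
  induction t with
  | ret a =>
    rintro M ⟨V, h, hV⟩
    rw [AlgStr.ext_ret]
    refine CTy.Rel.of_steps ((h.plug (.handle _)).beta (.handleRet _ _ _ _)) ?_
    rw [Comp.subst_ups_sub1]
    exact hN _ _ (hγ.cons hV)
  | op s t ih =>
    rintro M ⟨K, o, V, h, hV, hK⟩
    obtain ⟨rfl, hV⟩ := hV
    rw [AlgStr.ext_op]
    refine CTy.Rel.of_steps ((h.plug (.handle _)).beta (.handleOp K s.1 V _ _ _ s.1.2)) ?_
    rw [Comp.subst_ups_sub2]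
    -- What remains is that the captured continuation, a thunk, is related to the function sending
    -- an arity element to the fold of its subtree.
    refine hcl s.1 _ _ ((hγ.cons hV).cons ?_)
    intro a W hW
    refine CTy.Rel.of_steps ((Beta.force _).steps.plug (.basic (.app W))) ?_
    refine CTy.Rel.of_beta (.app _ _) ?_
    -- The resumed continuation becomes the original handler around `K[return W]`, to which the
    -- induction hypothesis for the subtree at `a` applies.
    simp only [Comp.subst, HCtx.rename_succ_plug_sub1, Hdl.rename_succ_sub1]
    refine ih a _ (hK a W ?_)
    exact hW

end

/-! ### The fundamental lemma -/

mutual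
-- Each rule is matched by its compatibility lemma. This serves only the two phrases placed in the
-- hole; the context around them is treated by `PVal.exists_sem`.
theorem DVal.semVal {Θ : TyEnv} {Γ : Env} {V : Val} {A : VTy} :
    ∀ d : DVal Θ Γ V A, SemVal Γ V A (d.sem θ)
  | .var _ h => .var h
  | .unit _ => .unit
  | .pair _ dV dW => .pair dV.semVal dW.semVal
  | .inj _ hl dV => .inj ⟨_, hl⟩ dV.semVal
  | .thunk _ dM => .thunk dM.semComp
theorem DComp.semComp {Θ : TyEnv} {Γ : Env} {E : Eff} {M : Comp} {C : CTy} :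
    ∀ d : DComp Θ Γ E M C, SemComp Γ E M C (d.sem θ)
  | .split _ dV dM => .split dV.semVal dM.semComp
  | .case _ dV dM => .case dV.semVal (fun l => (dM l).semComp)
  | .force _ dV => .force dV.semVal
  | .ret _ dV => .ret dV.semVal
  | .seq _ dM dN => .seq dM.semComp dN.semComp
  | .lam _ dM => .lam dM.semComp
  | .app _ dM dV => .app dM.semComp dV.semVal
  | .pair _ dM dN => .pair dM.semComp dN.semComp
  | .prj1 _ dM => .prj1 dM.semComp
  | .prj2 _ dM => .prj2 dM.semComp
  | .op ho _ dV => .op ⟨_, ho⟩ dV.semVal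
  | .handle _ dM dH => .handle dM.semComp dH.semHdl
theorem DHdl.semHdl {Θ : TyEnv} {Γ : Env} {H : Hdl} {A : VTy} {E E' : Eff} {C : CTy} :
    ∀ d : DHdl Θ Γ H A E E' C, SemHdl Γ H A E E' C (d.sem θ)
  | .mk _ dN dcl => .mk dN.semComp (fun o => (dcl o).semComp)
end

/-! ### Plugged contexts -/

theorem nonempty_lookup : ∀ {Γ : Env} {x : ℕ} {A : VTy}, Γ[x]? = some A → Nonempty (Lookup Γ x A)
  | [], _, _, h => by simp at h
  | B :: Γ, 0, A, h => by
    obtain rfl : B = A := by simpa using h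
    exact ⟨.zero⟩
  | B :: Γ, x + 1, A, h =>
    (nonempty_lookup (Γ := Γ) (x := x) (by simpa using h)).map .succ

/-- At a hole the phrases live in a smaller environment, reached through `ρ`. The map `r` looks each
of its variables up in `Γ`, so that the function realized at the hole can be precomposed with it. -/
theorem Env.exists_restrict (Γ : Env) : ∀ (Γ₀ : Env) (ρ : ℕ → ℕ),
    (∀ (x : ℕ) (A : VTy), Γ₀[x]? = some A → Γ[ρ x]? = some A) →
    ∃ r : Env.sem θ Γ → Env.sem θ Γ₀, ∀ γ σ, Env.Rel θ Γ γ σ →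
      Env.Rel θ Γ₀ (r γ) (fun x => σ (ρ x))
  | [], _, _ => ⟨fun _ => PUnit.unit, fun _ _ _ _ _ l => nomatch l⟩
  | A :: Γ₀, ρ, h => by
    obtain ⟨r, hr⟩ := Env.exists_restrict Γ Γ₀ (fun x => ρ (x + 1))
      (fun x B hx => h (x + 1) B (by simpa using hx))
    obtain ⟨l⟩ := nonempty_lookup (h 0 A rfl)
    refine ⟨fun γ => (l.sem θ γ, r γ), fun γ σ hγ x B k => ?_⟩
    cases k with
    | zero => exact hγ _ _ l
    | succ k => exact hr γ σ hγ _ _ k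

variable (θ) in
/-- The two phrases of a hole realize the same function. -/
def Hole.Sem : Hole → Prop
  | .val _ Γ V₁ V₂ A => ∃ f : Env.sem θ Γ → A.sem θ, SemVal Γ V₁ A f ∧ SemVal Γ V₂ A f
  | .comp _ Γ E M₁ M₂ C =>
      ∃ f : Env.sem θ Γ → C.car θ E, SemComp Γ E M₁ C f ∧ SemComp Γ E M₂ C f

mutual
-- The compatibility lemmas fix the realized function from those of the premises alone, so using
-- each lemma on both sides keeps that function common. Coherence of derivations is never needed.
theorem PVal.exists_sem {h : Hole} {Θ : TyEnv} {Γ : Env} {V₁ V₂ : Val} {A : VTy}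
    (hh : h.Sem θ) : PVal h Θ Γ V₁ V₂ A →
    ∃ f : Env.sem θ Γ → A.sem θ, SemVal Γ V₁ A f ∧ SemVal Γ V₂ A f
  | .hole _ _ hΓ => by
    obtain ⟨f, h₁, h₂⟩ := hh
    obtain ⟨r, hr⟩ := Env.exists_restrict (θ := θ) _ _ _ hΓ.2
    refine ⟨fun γ => f (r γ), fun γ σ hγ => ?_, fun γ σ hγ => ?_⟩ <;> rw [Val.subst_rename]
    · exact h₁ _ _ (hr γ σ hγ)
    · exact h₂ _ _ (hr γ σ hγ)
  | .var _ hx => (nonempty_lookup hx).elim fun l => ⟨_, .var l, .var l⟩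
  | .unit _ => ⟨_, .unit, .unit⟩
  | .pair _ pV pW =>
    let ⟨_, hV₁, hV₂⟩ := pV.exists_sem hh
    let ⟨_, hW₁, hW₂⟩ := pW.exists_sem hh
    ⟨_, .pair hV₁ hW₁, .pair hV₂ hW₂⟩
  | .inj _ hl pV =>
    let ⟨_, h₁, h₂⟩ := pV.exists_sem hh
    ⟨_, .inj ⟨_, hl⟩ h₁, .inj ⟨_, hl⟩ h₂⟩
  | .thunk _ pM =>
    let ⟨_, h₁, h₂⟩ := pM.exists_sem hh
    ⟨_, .thunk h₁, .thunk h₂⟩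
theorem PComp.exists_sem {h : Hole} {Θ : TyEnv} {Γ : Env} {E : Eff} {M₁ M₂ : Comp} {C : CTy}
    (hh : h.Sem θ) : PComp h Θ Γ E M₁ M₂ C →
    ∃ f : Env.sem θ Γ → C.car θ E, SemComp Γ E M₁ C f ∧ SemComp Γ E M₂ C f
  | .hole _ _ hΓ => by
    obtain ⟨f, h₁, h₂⟩ := hh
    obtain ⟨r, hr⟩ := Env.exists_restrict (θ := θ) _ _ _ hΓ.2
    refine ⟨fun γ => f (r γ), fun γ σ hγ => ?_, fun γ σ hγ => ?_⟩ <;> rw [Comp.subst_rename]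
    · exact h₁ _ _ (hr γ σ hγ)
    · exact h₂ _ _ (hr γ σ hγ)
  | .split _ pV pM =>
    let ⟨_, hV₁, hV₂⟩ := pV.exists_sem hh
    let ⟨_, hM₁, hM₂⟩ := pM.exists_sem hh
    ⟨_, .split hV₁ hM₁, .split hV₂ hM₂⟩
  | .case _ pV pM => by
    obtain ⟨_, hV₁, hV₂⟩ := pV.exists_sem hh
    -- One family of functions has to serve the branches on both sides, hence a simultaneous choice.
    choose g hM₁ hM₂ using fun l => (pM l).exists_sem hh
    exact ⟨_, .case hV₁ hM₁, .case hV₂ hM₂⟩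
  | .force _ pV =>
    let ⟨_, h₁, h₂⟩ := pV.exists_sem hh
    ⟨_, .force h₁, .force h₂⟩
  | .ret _ pV =>
    let ⟨_, h₁, h₂⟩ := pV.exists_sem hh
    ⟨_, .ret h₁, .ret h₂⟩
  | .seq _ pM pN =>
    let ⟨_, hM₁, hM₂⟩ := pM.exists_sem hh
    let ⟨_, hN₁, hN₂⟩ := pN.exists_sem hh
    ⟨_, .seq hM₁ hN₁, .seq hM₂ hN₂⟩
  | .lam _ pM =>
    let ⟨_, h₁, h₂⟩ := pM.exists_sem hh
    ⟨_, .lam h₁, .lam h₂⟩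
  | .app _ pM pV =>
    let ⟨_, hM₁, hM₂⟩ := pM.exists_sem hh
    let ⟨_, hV₁, hV₂⟩ := pV.exists_sem hh
    ⟨_, .app hM₁ hV₁, .app hM₂ hV₂⟩
  | .pair _ pM pN =>
    let ⟨_, hM₁, hM₂⟩ := pM.exists_sem hh
    let ⟨_, hN₁, hN₂⟩ := pN.exists_sem hh
    ⟨_, .pair hM₁ hN₁, .pair hM₂ hN₂⟩
  | .prj1 _ pM =>
    let ⟨_, h₁, h₂⟩ := pM.exists_sem hh
    ⟨_, .prj1 h₁, .prj1 h₂⟩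
  | .prj2 _ pM =>
    let ⟨_, h₁, h₂⟩ := pM.exists_sem hh
    ⟨_, .prj2 h₁, .prj2 h₂⟩
  | .op ho _ pV =>
    let ⟨_, h₁, h₂⟩ := pV.exists_sem hh
    ⟨_, .op ⟨_, ho⟩ h₁, .op ⟨_, ho⟩ h₂⟩
  | .handle _ pM pH =>
    let ⟨_, hM₁, hM₂⟩ := pM.exists_sem hh
    let ⟨_, hH₁, hH₂⟩ := pH.exists_sem hh
    ⟨_, .handle hM₁ hH₁, .handle hM₂ hH₂⟩
theorem PHdl.exists_sem {h : Hole} {Θ : TyEnv} {Γ : Env} {H₁ H₂ : Hdl} {A : VTy} {E E' : Eff}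
    {C : CTy} (hh : h.Sem θ) : PHdl h Θ Γ H₁ H₂ A E E' C →
    ∃ f : Env.sem θ Γ → HdlSem θ A E E' C, SemHdl Γ H₁ A E E' C f ∧ SemHdl Γ H₂ A E E' C f
  | .mk _ pN pcl => by
    obtain ⟨_, hN₁, hN₂⟩ := pN.exists_sem hh
    choose g hcl₁ hcl₂ using fun o => (pcl o).exists_sem hh
    exact ⟨_, .mk hN₁ hcl₁, .mk hN₂ hcl₂⟩
end

/-! ### Adequacy -/

/-- At ground types the relation prescribes every constructor of the value, with no clause involving
reduction. -/
theorem Ground.rel_unique {G : VTy} (hG : Ground G) : ∀ {g : G.sem θ} {V W : Val},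
    G.Rel θ g V → G.Rel θ g W → V = W := by
  induction hG with
  | unit =>
    intro g V W hV hW
    rw [hV, hW]
  | prod _ _ ihA ihB =>
    intro g V W hV hW
    obtain ⟨V₁, V₂, rfl, hV₁, hV₂⟩ := hV
    obtain ⟨W₁, W₂, rfl, hW₁, hW₂⟩ := hW
    rw [ihA hV₁ hW₁, ihB hV₂ hW₂]
  | variant _ ih =>
    intro g V W hV hW
    obtain ⟨V', rfl, hV⟩ := hV
    obtain ⟨W', rfl, hW⟩ := hW
    rw [ih _ hV hW]

/-- The pure signature has no symbols, so the tree is a leaf; termination is thus part of what the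
relation gives. -/
theorem exists_steps_ret {G : VTy} (hG : Ground G) {M₁ M₂ : Comp}
    {t : Free (Eff.pure.sem θ) (G.sem θ)}
    (h₁ : t.Rel (Eff.pure.Rel θ) (fun a V => G.Rel θ a V) M₁)
    (h₂ : t.Rel (Eff.pure.Rel θ) (fun a V => G.Rel θ a V) M₂) :
    ∃ V, Steps M₁ (.ret V) ∧ Steps M₂ (.ret V) := by
  cases t with
  | ret a =>
    obtain ⟨V, hV, hVa⟩ := h₁
    obtain ⟨W, hW, hWa⟩ := h₂
    obtain rfl := hG.rel_unique hVa hWa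
    exact ⟨V, hV, hW⟩
  | op s t => exact absurd s.1.2 (Finset.notMem_empty _)

theorem ctxEquiv_of_sem {h : Hole} (hh : h.Sem θ) : CtxEquiv h := by
  intro G hG M₁ M₂ p V _
  obtain ⟨f, h₁, h₂⟩ := p.exists_sem hh
  have hnil : Env.Rel θ [] PUnit.unit .var := fun _ _ l => nomatch l
  have h₁ := h₁ _ _ hnil
  have h₂ := h₂ _ _ hnil
  rw [Comp.subst_var] at h₁ h₂
  obtain ⟨W, hW₁, hW₂⟩ := exists_steps_ret hG h₁ h₂
  -- Any value returned by one side is the shared `W` by determinism, and the other side returns `W`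
  -- as well.
  constructor <;> intro hV
  · rwa [hV.ret_unique hW₁]
  · rwa [hV.ret_unique hW₂]

end LamEff

theorem mainTheorem5 :
    (∀ (Θ : LamEff.TyEnv) (Γ : LamEff.Env) (V W : LamEff.Val) (A : LamEff.VTy)
      (dV : LamEff.DVal Θ Γ V A) (dW : LamEff.DVal Θ Γ W A),
      (∀ θ : LamEff.TyAssign.{u}, dV.sem θ = dW.sem θ) →
        LamEff.CtxEquiv (LamEff.Hole.val Θ Γ V W A)) ∧
    (∀ (Θ : LamEff.TyEnv) (Γ : LamEff.Env) (E : LamEff.Eff) (M N : LamEff.Comp) (C : LamEff.CTy)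
      (dM : LamEff.DComp Θ Γ E M C) (dN : LamEff.DComp Θ Γ E N C),
      (∀ θ : LamEff.TyAssign.{u}, dM.sem θ = dN.sem θ) →
        LamEff.CtxEquiv (LamEff.Hole.comp Θ Γ E M N C)) := by
  refine ⟨fun Θ Γ V W A dV dW h => ?_, fun Θ Γ E M N C dM dN h => ?_⟩
  -- A single assignment suffices, and nothing depends on which one.
  · exact LamEff.ctxEquiv_of_sem (θ := fun _ => PUnit) ⟨_, dV.semVal, h _ ▸ dW.semVal⟩
  · exact LamEff.ctxEquiv_of_sem (θ := fun _ => PUnit) ⟨_, dM.semComp, h _ ▸ dN.semComp⟩
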